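/- Let $\gamma>0$ and let $n\ge 2$ be an integer. Let $$g_\gamma(t)=\left(\tfrac{\pi}{2\gamma}\right)^{1/2}\operatorname{sech}\left(\tfrac{\pi t}{\gamma}\right),\qquad t\in\mathbb{R},$$ be the normalized hyperbolic secant dilated by $\gamma$. For $a,b>0$ consider the Gabor system of all time-frequency shifts $$\pi(x,\omega)g_\gamma(t)=g_\gamma(t-x)\,e^{2\pi i\omega t},\qquad (x,\omega)\in a\mathbb{Z}\times b\mathbb{Z}.$$ Denote by $A(a,b)$ the largest and by $B(a,b)$ the smallest constant such that $$A\,\|f\|_{2}^2\le\sum_{\lambda\in a\mathbb{Z}\times b\mathbb{Z}}|\langle f,\pi(\lambda)g_\gamma\rangle|^2\le B\,\|f\|_{2}^2\qquad\text{for all } f\in L^2(\mathbb{R}).$$ Then for all $a,b>0$ with $(ab)^{-1}=n$ the Gabor system is a frame, i.e. $0<A(a,b)\le B(a,b)<\infty$, and with $$(a_*,b_*)=\left(\tfrac{\gamma}{\sqrt n},\tfrac{1}{\gamma\sqrt n}\right)$$ we have $$A(a,b)\le A(a_*,b_*),\qquad B(a,b)\ge B(a_*,b_*),\qquad \frac{B(a,b)}{A(a,b)}\ge\frac{B(a_*,b_*)}{A(a_*,b_*)},$$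 and in each of the three inequalities equality holds if and only if $(a,b)=(a_*,b_*)$. In other words, among the rectangular lattices $a\mathbb{Z}\times b\mathbb{Z}$ of density $n$, the lattice $\frac{\gamma}{\sqrt n}\mathbb{Z}\times\frac{1}{\gamma\sqrt n}\mathbb{Z}$ is the unique maximizer of the lower frame bound, the unique minimizer of the upper frame bound and the unique minimizer of the condition number. -/

import Mathlib

open scoped ENNReal
open MeasureTheory

noncomputable section

namespace Gabor

/-- The hyperbolic secant. -/
def sech (x : ℝ) : ℝ := 1 / Real.cosh x

/-- The normalized hyperbolic secant dilated by `γ`,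
`t ↦ (π / (2 γ)) ^ (1 / 2) * sech (π t / γ)`, as a complex valued window on `ℝ`. -/
def sechWindow (γ : ℝ) (t : ℝ) : ℂ :=
  ((Real.sqrt (Real.pi / (2 * γ)) * sech (Real.pi * t / γ) : ℝ) : ℂ)

/-- The time-frequency shift `π(x, ω) g = M_ω T_x g`, that is
`t ↦ g (t - x) * exp (2 π i ω t)`. -/
def timeFreqShift (l : ℝ × ℝ) (g : ℝ → ℂ) (t : ℝ) : ℂ :=
  g (t - l.1) * Complex.exp (2 * Real.pi * Complex.I * l.2 * t)

/-- The rectangular lattice `a ℤ × b ℤ` in the time-frequency plane. -/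
def rectLattice (a b : ℝ) : AddSubgroup (ℝ × ℝ) :=
  (AddSubgroup.zmultiples a).prod (AddSubgroup.zmultiples b)

/-- The short-time Fourier transform `V_g f (l) = ⟨f, π(l) g⟩`. -/
def stft (g : ℝ → ℂ) (f : Lp ℂ 2 (volume : Measure ℝ)) (l : ℝ × ℝ) : ℂ :=
  ∫ t : ℝ, f t * starRingEnd ℂ (timeFreqShift l g t)

/-- The sum `∑_{l ∈ Λ} |⟨f, π(l) g⟩|²`, with values in `[0, ∞]`. -/
def gaborSum (g : ℝ → ℂ) (Λ : AddSubgroup (ℝ × ℝ)) (f : Lp ℂ 2 (volume : Measure ℝ)) : ℝ≥0∞ :=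
  ∑' l : Λ, ‖stft g f (l : ℝ × ℝ)‖ₑ ^ 2

/-- The sharp lower frame bound: the largest `A` with
`A ‖f‖² ≤ ∑_{l ∈ Λ} |⟨f, π(l) g⟩|²` for all `f` in `L²(ℝ)`. -/
def lowerFrameBound (g : ℝ → ℂ) (Λ : AddSubgroup (ℝ × ℝ)) : ℝ≥0∞ :=
  sSup {A : ℝ≥0∞ | ∀ f : Lp ℂ 2 (volume : Measure ℝ), A * ‖f‖ₑ ^ 2 ≤ gaborSum g Λ f}

/-- The sharp upper frame bound: the smallest `B` with
`∑_{l ∈ Λ} |⟨f, π(l) g⟩|² ≤ B ‖f‖²` for all `f` in `L²(ℝ)`. -/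
def upperFrameBound (g : ℝ → ℂ) (Λ : AddSubgroup (ℝ × ℝ)) : ℝ≥0∞ :=
  sInf {B : ℝ≥0∞ | ∀ f : Lp ℂ 2 (volume : Measure ℝ), gaborSum g Λ f ≤ B * ‖f‖ₑ ^ 2}

/-- The Gabor system `{π(l) g | l ∈ Λ}` is a frame of `L²(ℝ)`: the frame inequality holds
with some constants `0 < A ≤ B < ∞`. -/
def IsGaborFrame (g : ℝ → ℂ) (Λ : AddSubgroup (ℝ × ℝ)) : Prop :=
  ∃ A B : ℝ, 0 < A ∧ A ≤ B ∧ ∀ f : Lp ℂ 2 (volume : Measure ℝ),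
    ENNReal.ofReal A * ‖f‖ₑ ^ 2 ≤ gaborSum g Λ f ∧
      gaborSum g Λ f ≤ ENNReal.ofReal B * ‖f‖ₑ ^ 2

/-- The frame condition number `B / A`, the quotient of the sharp frame bounds. -/
def conditionNumber (g : ℝ → ℂ) (Λ : AddSubgroup (ℝ × ℝ)) : ℝ≥0∞ :=
  upperFrameBound g Λ / lowerFrameBound g Λ

end Gabor

end

/-!
The window `sech` has the property that for a rectangular lattice of integer density `n` the frame
operator splits into a function of time plus a function of frequency. Parseval in the modulations
turns the Gabor sum of `f` into an integral over a cell of length `n a = 1 / b` of the quadratic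
forms `∑ₖ |∑ⱼ uⱼ sech (τ + j n α - k α)|²`, where `α = π a / γ`, `τ = π t / γ` and
`uⱼ = f (t + j n a)`. By
`sech x sech y = (tanh x - tanh y) / sinh (x - y)` the sums over `k` of the mixed terms telescope to
values independent of `τ`, so that the form is `∑ₖ sech² (τ - k α) ‖u‖²` plus a Toeplitz form with
the coefficients `n · 2 m / sinh (n α m)` (`hasSum_fibre`).

The extreme values of the two parts are attained independently of each other. The Toeplitz part is
at most the sum of its positive coefficients, and it is bounded below because with `n = 1` the same
identity exhibits a sum of squares (`neg_le_toeplitz`). The diagonal part is largest at `τ = 0`,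
since the Fourier transform of `sech²` is positive (`sechPeriod_le_zero`, by Poisson summation and
the reflection formula for `Γ`), and smallest at `τ = α / 2`, where the alternating sum of the
translates of `sech` vanishes (`sechPeriod_half_le`). Combs concentrated near these points with
constant or alternating signs show that the bounds are sharp. This gives
`A = n (1 - L (π² / α) - L (n α))` and `B = n (1 + U (π² / α) + U (n α))`
(`lowerFrameBound_eq`, `upperFrameBound_eq`) with `U s = ∑_{m ≠ 0} s m / sinh (s m)` and
`L s = (s / 2) ∑ sech² (s (k + 1 / 2))`.

The two arguments have the product `n π²`, and `α = π / √n` makes them equal. It remains to show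
that `L s + L t` and `U s + U t` with `s t = n π²` are smallest exactly at `s = t`. Both functions
are sums of terms which are strictly convex in `log s` for `s` not too small (`lowerProfile_convex`,
`upperProfile_convex`). If `s` or `t` is smaller, then the single value there already exceeds twice
the value at `π √n`, because both functions decrease; this is where `n ≥ 2` enters. For `s < π` the
monotonicity of `L` comes from the functional equation `L s + L (π² / s) = 1`, which
also gives `A > 0`.
-/

namespace Gabor

open Filter Topology Real

/-! ### The hyperbolic secant and its lattice sums -/

lemma sech_pos (x : ℝ) : 0 < sech x := one_div_pos.2 (cosh_pos x)

lemma sech_le_one (x : ℝ) : sech x ≤ 1 := by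
  rw [sech, div_le_one (cosh_pos x)]; exact one_le_cosh x

lemma sech_neg (x : ℝ) : sech (-x) = sech x := by simp [sech]

lemma continuous_sech : Continuous sech := by
  unfold sech
  exact continuous_const.div continuous_cosh fun x => (cosh_pos x).ne'

lemma sech_le_exp (x : ℝ) : sech x ≤ 2 * exp (-|x|) := by
  have h : exp |x| ≤ 2 * cosh x := by
    rw [← cosh_abs x, cosh_eq]; linarith [exp_pos (-|x|)]
  rw [sech, div_le_iff₀ (cosh_pos x)]
  calc (1 : ℝ) = exp (-|x|) * exp |x| := by rw [← exp_add]; simp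
    _ ≤ exp (-|x|) * (2 * cosh x) := by gcongr
    _ = _ := by ring

lemma sech_mul_sech (x y : ℝ) : sinh (x - y) * (sech x * sech y) = tanh x - tanh y := by
  have hx := (cosh_pos x).ne'
  have hy := (cosh_pos y).ne'
  rw [sinh_sub, tanh_eq_sinh_div_cosh, tanh_eq_sinh_div_cosh, sech, sech]
  field_simp

lemma sech_sq (x : ℝ) : sech x ^ 2 = 1 - tanh x ^ 2 := by
  have hx := (cosh_pos x).ne'
  rw [sech, tanh_eq_sinh_div_cosh]
  field_simp
  linarith [cosh_sq x]

lemma hasDerivAt_tanh (x : ℝ) : HasDerivAt tanh (sech x ^ 2) x := by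
  have hx := (cosh_pos x).ne'
  have h := (hasDerivAt_sinh x).div (hasDerivAt_cosh x) hx
  have he : tanh = fun y => sinh y / cosh y := funext tanh_eq_sinh_div_cosh
  rw [he]
  convert! h using 1
  rw [sech]
  field_simp
  linarith [cosh_sq x]

lemma strictMono_tanh : StrictMono tanh :=
  strictMono_of_hasDerivAt_pos hasDerivAt_tanh fun x => pow_pos (sech_pos x) 2

lemma tendsto_tanh_atTop : Tendsto tanh atTop (𝓝 1) := by
  have h1 : ∀ x, 1 - 2 * exp (-x) * exp (-x) ≤ tanh x := fun x => by
    have := exp_pos x; have h2 := exp_pos (-x)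
    have h3 : exp x * exp (-x) = 1 := by rw [← exp_add]; simp
    rw [tanh_eq, le_div_iff₀ (by positivity)]
    nlinarith [mul_pos h2 h2, mul_pos (mul_pos h2 h2) h2]
  have h4 : Tendsto (fun x => exp (-x)) atTop (𝓝 0) := tendsto_exp_neg_atTop_nhds_zero
  refine tendsto_of_tendsto_of_tendsto_of_le_of_le ?_ tendsto_const_nhds h1
    fun x => (tanh_lt_one x).le
  simpa using tendsto_const_nhds.sub ((h4.const_mul 2).mul h4)

lemma summable_exp_neg_mul {α : ℝ} (hα : 0 < α) : Summable fun k : ℕ => exp (-(α * k)) := by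
  have := summable_geometric_of_lt_one (exp_pos (-α)).le (exp_lt_one_iff.2 (by linarith))
  refine this.congr fun k => ?_
  rw [← exp_nat_mul]; ring_nf

lemma summable_sech {α : ℝ} (hα : 0 < α) (τ : ℝ) : Summable fun k : ℤ => sech (τ - k * α) := by
  have hb : Summable fun k : ℤ => 2 * exp |τ| * exp (-(α * |(k : ℝ)|)) := by
    refine Summable.mul_left _ (Summable.of_nat_of_neg ?_ ?_)
    · simpa using summable_exp_neg_mul hα
    · simpa using summable_exp_neg_mul hα
  refine Summable.of_nonneg_of_le (fun k => (sech_pos _).le) (fun k => ?_) hb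
  refine (sech_le_exp _).trans ?_
  rw [mul_assoc, ← exp_add]
  gcongr
  have : |(k : ℝ) * α| ≤ |τ - k * α| + |τ| := by
    have := abs_sub_abs_le_abs_sub ((k : ℝ) * α) τ
    rw [abs_sub_comm] at this; linarith
  rw [abs_mul, abs_of_pos hα] at this
  linarith

lemma summable_sech_sq {α : ℝ} (hα : 0 < α) (τ : ℝ) :
    Summable fun k : ℤ => sech (τ - k * α) ^ 2 :=
  Summable.of_nonneg_of_le (fun k => sq_nonneg _)
    (fun k => by nlinarith [sech_pos (τ - k * α), sech_le_one (τ - k * α)]) (summable_sech hα τ)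

lemma hasSum_telescope {f : ℕ → ℝ} {l : ℝ} (hf : Monotone f) (hl : Tendsto f atTop (𝓝 l)) :
    HasSum (fun k => f (k + 1) - f k) (l - f 0) := by
  rw [hasSum_iff_tendsto_nat_of_nonneg fun k => sub_nonneg.2 (hf k.le_succ)]
  simp_rw [Finset.sum_range_sub]
  exact hl.sub_const _

lemma hasSum_tanh_add {α : ℝ} (hα : 0 < α) (y : ℝ) :
    HasSum (fun k : ℕ => tanh (y + (k + 1) * α) - tanh (y + k * α)) (1 - tanh y) := by
  have hlin : Tendsto (fun N : ℕ => y + (N : ℝ) * α) atTop atTop :=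
    tendsto_atTop_add_const_left _ y (tendsto_natCast_atTop_atTop.atTop_mul_const hα)
  have := hasSum_telescope (f := fun k : ℕ => tanh (y + k * α))
    (fun i j hij => strictMono_tanh.monotone (by gcongr)) (tendsto_tanh_atTop.comp hlin)
  simpa using this

/-- Telescoping over `ℤ`: the total variation of `tanh` is `2`. -/
lemma hasSum_tanh_sub {α : ℝ} (hα : 0 < α) (x : ℝ) :
    HasSum (fun k : ℤ => tanh (x + α - k * α) - tanh (x - k * α)) 2 := by
  have h1 : HasSum (fun k : ℕ => tanh (x + α - ((k : ℤ) : ℝ) * α) - tanh (x - ((k : ℤ) : ℝ) * α))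
      (1 - tanh (-(x + α))) := by
    refine (hasSum_tanh_add hα (-(x + α))).congr_fun fun k => ?_
    have e1 : -(x + α) + (k + 1) * α = -(x - ((k : ℤ) : ℝ) * α) := by push_cast; ring
    have e2 : -(x + α) + k * α = -(x + α - ((k : ℤ) : ℝ) * α) := by push_cast; ring
    rw [e1, e2, tanh_neg, tanh_neg]; ring
  have h2 : HasSum (fun k : ℕ => tanh (x + α - ((-((k : ℤ) + 1) : ℤ) : ℝ) * α)
      - tanh (x - ((-((k : ℤ) + 1) : ℤ) : ℝ) * α)) (1 - tanh (x + α)) := by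
    refine (hasSum_tanh_add hα (x + α)).congr_fun fun k => ?_
    have e1 : x + α - ((-((k : ℤ) + 1) : ℤ) : ℝ) * α = x + α + (k + 1) * α := by push_cast; ring
    have e2 : x - ((-((k : ℤ) + 1) : ℤ) : ℝ) * α = x + α + k * α := by push_cast; ring
    rw [e1, e2]
  have h := HasSum.of_nat_of_neg_add_one
    (f := fun k : ℤ => tanh (x + α - k * α) - tanh (x - k * α)) h1 h2
  rw [tanh_neg] at h
  have e : 1 - -tanh (x + α) + (1 - tanh (x + α)) = 2 := by ring
  rwa [e] at h

lemma hasSum_tanh_sub_nat {α : ℝ} (hα : 0 < α) (x : ℝ) (m : ℕ) :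
    HasSum (fun k : ℤ => tanh (x + m * α - k * α) - tanh (x - k * α)) (2 * m) := by
  induction m with
  | zero => simp
  | succ m ih =>
    have := ih.add (hasSum_tanh_sub hα (x + m * α))
    convert! this using 1
    · funext k; push_cast; ring_nf
    · push_cast; ring

lemma hasSum_tanh_sub_int {α : ℝ} (hα : 0 < α) (x : ℝ) (m : ℤ) :
    HasSum (fun k : ℤ => tanh (x + m * α - k * α) - tanh (x - k * α)) (2 * m) := by
  obtain ⟨m, rfl | rfl⟩ := m.eq_nat_or_neg
  · simpa using hasSum_tanh_sub_nat hα x m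
  · have := (hasSum_tanh_sub_nat hα (x - m * α) m).neg
    convert! this using 1
    · funext k; push_cast; ring_nf
    · push_cast; ring

/-- The correlation coefficients `2 m / sinh (β m)`. At `m = 0` the value is `0`, so that sums over
all `m` have no diagonal term. -/
noncomputable def corr (β : ℝ) (m : ℤ) : ℝ := 2 * m / sinh (β * m)

lemma corr_zero (β : ℝ) : corr β 0 = 0 := by simp [corr]

lemma corr_neg (β : ℝ) (m : ℤ) : corr β (-m) = corr β m := by
  simp [corr, neg_div_neg_eq]

lemma corr_nonneg {β : ℝ} (hβ : 0 < β) (m : ℤ) : 0 ≤ corr β m := by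
  rcases le_total 0 m with h | h
  · have : (0 : ℝ) ≤ m := by exact_mod_cast h
    exact div_nonneg (by linarith) (sinh_nonneg_iff.2 (by positivity))
  · have : (m : ℝ) ≤ 0 := by exact_mod_cast h
    exact div_nonneg_of_nonpos (by linarith)
      (sinh_nonpos_iff.2 (mul_nonpos_of_nonneg_of_nonpos hβ.le this))

/-- The periodization `∑ sech² (τ - k α)`. -/
noncomputable def sechPeriod (α τ : ℝ) : ℝ := ∑' k : ℤ, sech (τ - k * α) ^ 2

/-- The product of `sech` with a lattice translate is a multiple of a difference of `tanh`, so its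
lattice sum telescopes. -/
lemma hasSum_sech_mul_sech {α : ℝ} (hα : 0 < α) (τ : ℝ) {m : ℤ} (hm : m ≠ 0) :
    HasSum (fun k : ℤ => sech (τ + m * α - k * α) * sech (τ - k * α)) (corr α m) := by
  have hs : sinh (α * m) ≠ 0 := by
    rw [Ne, sinh_eq_zero]
    exact mul_ne_zero hα.ne' (by exact_mod_cast hm)
  have := (hasSum_tanh_sub_int hα τ m).div_const (sinh (α * m))
  refine this.congr_fun fun k => ?_
  rw [← sech_mul_sech]
  have : τ + m * α - k * α - (τ - k * α) = α * m := by ring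
  rw [this, mul_div_cancel_left₀ _ hs]

lemma hasSum_sechPeriod {α : ℝ} (hα : 0 < α) (τ : ℝ) (m : ℤ) :
    HasSum (fun k : ℤ => sech (τ + m * α - k * α) ^ 2) (sechPeriod α τ) := by
  have := (Equiv.subRight m).hasSum_iff.2 (summable_sech_sq hα τ).hasSum
  refine this.congr_fun fun k => ?_
  simp only [Function.comp, Equiv.subRight_apply]
  push_cast; ring_nf

lemma corr_mul_nat {α : ℝ} {n : ℕ} (m : ℤ) :
    corr α (n * m) = n * corr (n * α) m := by
  simp only [corr]; push_cast; ring_nf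

/-- The products of two lattice translates of `sech` sum to something which does not depend on the
offset `τ`, unless the two translates coincide. -/
lemma hasSum_sech_translates {α : ℝ} (hα : 0 < α) {n : ℕ} (hn : n ≠ 0) (τ : ℝ) (i j : ℤ) :
    HasSum (fun k : ℤ => sech (τ + i * (n * α) - k * α) * sech (τ + j * (n * α) - k * α))
      ((if i = j then sechPeriod α τ else 0) + n * corr (n * α) (i - j)) := by
  split_ifs with h
  · subst h
    have := hasSum_sechPeriod hα τ (i * n)
    simp only [sub_self, corr_zero, mul_zero, add_zero]
    refine this.congr_fun fun k => ?_
    push_cast; ring_nf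
  · rw [zero_add, ← corr_mul_nat]
    have := hasSum_sech_mul_sech hα (τ + j * (n * α)) (m := n * (i - j))
      (mul_ne_zero (by exact_mod_cast hn) (sub_ne_zero.2 h))
    refine this.congr_fun fun k => ?_
    push_cast; ring_nf

/-- The Toeplitz form with coefficients `corr β`, on finitely supported sequences. -/
noncomputable def toeplitz (β : ℝ) (S : Finset ℤ) (u : ℤ → ℂ) : ℝ :=
  ∑ i ∈ S, ∑ j ∈ S, corr β (i - j) * (u i * starRingEnd ℂ (u j)).re

/-- The frame operator identity on a fibre: the analysis coefficients of `u` have a diagonal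
part and a Toeplitz part. -/
lemma hasSum_fibre {α : ℝ} (hα : 0 < α) {n : ℕ} (hn : n ≠ 0) (τ : ℝ) (S : Finset ℤ) (u : ℤ → ℂ) :
    HasSum (fun k : ℤ => ‖∑ j ∈ S, u j * (sech (τ + j * (n * α) - k * α) : ℂ)‖ ^ 2)
      (sechPeriod α τ * ∑ j ∈ S, ‖u j‖ ^ 2 + n * toeplitz (n * α) S u) := by
  have hexp : ∀ k : ℤ, ‖∑ j ∈ S, u j * (sech (τ + j * (n * α) - k * α) : ℂ)‖ ^ 2 =
      ∑ i ∈ S, ∑ j ∈ S, sech (τ + i * (n * α) - k * α) * sech (τ + j * (n * α) - k * α) *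
        (u i * starRingEnd ℂ (u j)).re := fun k => by
    have h1 : ∀ z : ℂ, ‖z‖ ^ 2 = (z * starRingEnd ℂ z).re := fun z => by
      rw [Complex.mul_conj, Complex.ofReal_re, Complex.normSq_eq_norm_sq]
    rw [h1, map_sum, Finset.sum_mul_sum, Complex.re_sum]
    refine Finset.sum_congr rfl fun i _ => ?_
    rw [Complex.re_sum]
    refine Finset.sum_congr rfl fun j _ => ?_
    rw [map_mul, Complex.conj_ofReal, ← Complex.re_ofReal_mul]
    push_cast; ring_nf
  simp_rw [hexp]
  have := hasSum_sum fun i (_ : i ∈ S) => hasSum_sum fun j (_ : j ∈ S) =>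
    (hasSum_sech_translates hα hn τ i j).mul_right (u i * starRingEnd ℂ (u j)).re
  convert! this using 1
  simp only [add_mul, Finset.sum_add_distrib, ite_mul, zero_mul, Finset.sum_ite_eq, toeplitz,
    Finset.mul_sum, mul_assoc]
  congr 1
  refine Finset.sum_congr rfl fun i hi => ?_
  rw [if_pos hi, Complex.mul_conj, Complex.ofReal_re, Complex.normSq_eq_norm_sq]

/-- The Toeplitz form is bounded below: the fibre identity with `n = 1`, where the left hand side
is a sum of squares. -/
lemma neg_le_toeplitz {β : ℝ} (hβ : 0 < β) (τ : ℝ) (S : Finset ℤ) (u : ℤ → ℂ) :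
    -(sechPeriod β τ * ∑ j ∈ S, ‖u j‖ ^ 2) ≤ toeplitz β S u := by
  have := (hasSum_fibre hβ one_ne_zero τ S u).nonneg fun k => sq_nonneg _
  simp only [Nat.cast_one, one_mul] at this
  linarith

/-! ### Poisson summation for `sech²` -/

/-- The function `v / sinh v`, with its limit value `1` at `0`. -/
noncomputable def sinhRatio (v : ℝ) : ℝ := if v = 0 then 1 else v / sinh v

lemma sinhRatio_pos (v : ℝ) : 0 < sinhRatio v := by
  unfold sinhRatio
  split_ifs with h
  · exact one_pos
  · rcases lt_or_gt_of_ne h with h | h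
    · exact div_pos_of_neg_of_neg h (sinh_neg_iff.2 h)
    · exact div_pos h (sinh_pos_iff.2 h)

lemma tanh_ratio (u : ℝ) : log ((1 + tanh u) / 2) - log (1 - (1 + tanh u) / 2) = 2 * u := by
  have h1 := neg_one_lt_tanh u
  have h2 := tanh_lt_one u
  rw [← log_div (by linarith) (by linarith), ← log_exp (2 * u)]
  congr 1
  have := exp_pos u
  have hh : exp (2 * u) = exp u * exp u := by rw [← exp_add]; ring_nf
  have hh' : exp u * exp (-u) = 1 := by rw [← exp_add]; simp
  rw [div_eq_iff (by linarith), hh, tanh_eq]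
  have := exp_pos (-u)
  field_simp
  linear_combination (-2 * exp u) * hh'

/-- The Fourier transform of `sech²` is a beta integral, by the substitution
`x = (1 + tanh u) / 2`. -/
lemma integral_sech_sq_mul_exp (w : ℂ) :
    ∫ u : ℝ, (sech u ^ 2 : ℂ) * Complex.exp (2 * w * u) =
      2 * Complex.betaIntegral (1 + w) (1 - w) := by
  have himg : (fun u => (1 + tanh u) / 2) '' Set.univ = Set.Ioo 0 1 := by
    ext x
    simp only [Set.image_univ, Set.mem_range, Set.mem_Ioo]
    constructor
    · rintro ⟨u, rfl⟩
      have h1 := neg_one_lt_tanh u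
      have h2 := tanh_lt_one u
      constructor <;> linarith
    · rintro ⟨h0, h1⟩
      obtain ⟨u, -, hu⟩ := tanh_surjOn (show 2 * x - 1 ∈ Set.Ioo (-1 : ℝ) 1 by
        constructor <;> linarith)
      exact ⟨u, by rw [hu]; ring⟩
  have hd : ∀ u ∈ Set.univ, HasDerivWithinAt (fun u => (1 + tanh u) / 2) (sech u ^ 2 / 2)
      Set.univ u := fun u _ =>
    (((hasDerivAt_tanh u).const_add 1).div_const 2).hasDerivWithinAt
  have hinj : Set.InjOn (fun u => (1 + tanh u) / 2) Set.univ := fun x _ y _ h => by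
    apply tanh_injective
    simp only at h
    linarith
  have key := integral_image_eq_integral_abs_deriv_smul MeasurableSet.univ hd hinj
    (fun x : ℝ => (x : ℂ) ^ (1 + w - 1) * (1 - (x : ℂ)) ^ (1 - w - 1))
  rw [himg, setIntegral_univ] at key
  rw [Complex.betaIntegral, intervalIntegral.integral_of_le zero_le_one,
    integral_Ioc_eq_integral_Ioo, key, ← integral_const_mul]
  congr 1
  funext u
  have h1 := neg_one_lt_tanh u
  have h2 := tanh_lt_one u
  have e1 : (((1 + tanh u) / 2 : ℝ) : ℂ) ≠ 0 := by
    rw [Complex.ofReal_ne_zero]; linarith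
  have e2 : ((1 - (1 + tanh u) / 2 : ℝ) : ℂ) ≠ 0 := by
    rw [Complex.ofReal_ne_zero]; linarith
  have e3 : (1 : ℂ) - (((1 + tanh u) / 2 : ℝ) : ℂ) = ((1 - (1 + tanh u) / 2 : ℝ) : ℂ) := by
    push_cast; ring
  rw [e3, Complex.cpow_def_of_ne_zero e1, Complex.cpow_def_of_ne_zero e2, ← Complex.exp_add,
    ← Complex.ofReal_log (by linarith), ← Complex.ofReal_log (by linarith),
    abs_of_nonneg (by positivity), Complex.real_smul]
  have e4 : (log ((1 + tanh u) / 2) : ℂ) * (1 + w - 1)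
      + (log (1 - (1 + tanh u) / 2) : ℂ) * (1 - w - 1) = 2 * w * u := by
    have := congrArg (fun r : ℝ => (r : ℂ)) (tanh_ratio u)
    push_cast at this ⊢
    linear_combination w * this
  rw [e4]
  push_cast; ring

lemma betaIntegral_eq_sinhRatio (ξ : ℝ) :
    Complex.betaIntegral (1 + Complex.I * ξ) (1 - Complex.I * ξ) = sinhRatio (π * ξ) := by
  rw [Complex.betaIntegral_eq_Gamma_mul_div _ _ (by simp) (by simp)]
  have : (1 + Complex.I * ξ) + (1 - Complex.I * ξ) = 2 := by ring
  rw [this, Complex.Gamma_ofNat_eq_factorial]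
  rcases eq_or_ne ξ 0 with rfl | h
  · simp [sinhRatio]
  · have hw : Complex.I * ξ ≠ 0 := mul_ne_zero Complex.I_ne_zero (by exact_mod_cast h)
    have hs : sinh (π * ξ) ≠ 0 := by
      rw [Ne, sinh_eq_zero]; exact mul_ne_zero pi_ne_zero h
    rw [add_comm, Complex.Gamma_add_one _ hw, mul_assoc, Complex.Gamma_mul_Gamma_one_sub]
    rw [sinhRatio, if_neg (mul_ne_zero pi_ne_zero h)]
    have : (π : ℂ) * (Complex.I * ξ) = (π * ξ : ℝ) * Complex.I := by push_cast; ring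
    rw [this, Complex.sin_mul_I, ← Complex.ofReal_sinh]
    have hs' : (sinh (π * ξ) : ℂ) ≠ 0 := by exact_mod_cast hs
    have := Complex.I_ne_zero
    push_cast
    field_simp
    simp

open FourierTransform in
lemma fourier_sech_sq {α : ℝ} (hα : 0 < α) (ξ : ℝ) :
    𝓕 (fun x : ℝ => ((sech (α * x) ^ 2 : ℝ) : ℂ)) ξ
      = ((2 / α * sinhRatio (π ^ 2 / α * ξ) : ℝ) : ℂ) := by
  rw [Real.fourier_real_eq_integral_exp_smul]
  have h1 : ∀ v : ℝ, Complex.exp (↑(-2 * π * v * ξ) * Complex.I) • ((sech (α * v) ^ 2 : ℝ) : ℂ) =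
      (fun u : ℝ => (sech u ^ 2 : ℂ) * Complex.exp (2 * (Complex.I * (-(π * ξ / α) : ℝ)) * u))
        (α * v) := fun v => by
    have hα' : (α : ℂ) ≠ 0 := by exact_mod_cast hα.ne'
    simp only [smul_eq_mul]
    rw [mul_comm]
    push_cast
    congr 2
    field_simp
  rw [integral_congr_ae (ae_of_all _ h1), Measure.integral_comp_mul_left
    (fun u : ℝ => (sech u ^ 2 : ℂ) * Complex.exp (2 * (Complex.I * (-(π * ξ / α) : ℝ)) * u)),
    integral_sech_sq_mul_exp,
    betaIntegral_eq_sinhRatio, abs_of_pos (by positivity), Complex.real_smul]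
  have : sinhRatio (π * -(π * ξ / α)) = sinhRatio (π ^ 2 / α * ξ) := by
    have : π * -(π * ξ / α) = -(π ^ 2 / α * ξ) := by ring
    rw [this]
    simp [sinhRatio, neg_div_neg_eq]
  rw [this]
  push_cast; ring

/-! ### Double sums of translates of `sech` -/

lemma summable_sign_sech {α : ℝ} (hα : 0 < α) (τ : ℝ) {ε : ℝ} (hε : |ε| = 1) :
    Summable fun k : ℤ => ε ^ k * sech (τ - k * α) := by
  refine Summable.of_norm ((summable_sech hα τ).congr fun k => ?_)
  rw [norm_mul, norm_zpow, norm_eq_abs, hε, one_zpow, one_mul, norm_eq_abs, abs_of_pos (sech_pos _)]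

/-- Expansion of the square of `∑ ε ^ k sech (τ - k α)` along the diagonals. -/
lemma hasSum_sign_corr {α : ℝ} (hα : 0 < α) (τ : ℝ) {ε : ℝ} (hε : ε ^ 2 = 1) :
    HasSum (fun m : ℤ => ε ^ m * corr α m)
      ((∑' k : ℤ, ε ^ k * sech (τ - k * α)) ^ 2 - sechPeriod α τ) := by
  have hε0 : ε ≠ 0 := by rintro rfl; norm_num at hε
  have habs : |ε| = 1 := by
    rcases sq_eq_one_iff.1 hε with rfl | rfl <;> simp
  have hs := summable_sign_sech hα τ habs
  have hprod := hs.hasSum.mul hs.hasSum (summable_mul_of_summable_norm hs.norm hs.norm)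
  -- the pair `(m, k)` stands for the product of the terms `k - m` and `k`
  let e : ℤ × ℤ ≃ ℤ × ℤ :=
    { toFun := fun p => (p.2 - p.1, p.2)
      invFun := fun p => (p.2 - p.1, p.2)
      left_inv := fun p => by simp
      right_inv := fun p => by simp }
  have h2 := e.hasSum_iff.2 hprod
  have h3 : ∀ m : ℤ, HasSum (fun k : ℤ => ((fun x : ℤ × ℤ => ε ^ x.1 * sech (τ - x.1 * α) *
      (ε ^ x.2 * sech (τ - x.2 * α))) ∘ e) (m, k))
      (ε ^ m * corr α m + if m = 0 then sechPeriod α τ else 0) := fun m => by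
    have hterm : ∀ k : ℤ, ((fun x : ℤ × ℤ => ε ^ x.1 * sech (τ - x.1 * α) *
        (ε ^ x.2 * sech (τ - x.2 * α))) ∘ e) (m, k) =
        ε ^ m * (sech (τ + m * α - k * α) * sech (τ - k * α)) := fun k => by
      simp only [Function.comp, e, Equiv.coe_fn_mk]
      have e1 : ε ^ (k - m) * ε ^ k = ε ^ m := by
        rw [← zpow_add₀ hε0]
        have : k - m + k = 2 * (k - m) + m := by ring
        rw [this, zpow_add₀ hε0, zpow_mul]
        have : ε ^ (2 : ℤ) = 1 := by exact_mod_cast hε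
        rw [this]; simp
      have e2 : τ - ((k - m : ℤ) : ℝ) * α = τ + m * α - k * α := by push_cast; ring
      rw [e2, ← e1]; ring
    simp_rw [hterm]
    split_ifs with h
    · subst h
      have := (hasSum_sechPeriod hα τ 0).mul_left (ε ^ (0 : ℤ))
      simpa [corr_zero, sq] using this
    · rw [add_zero]
      exact (hasSum_sech_mul_sech hα τ h).mul_left _
  have h4 := h2.prod_fiberwise h3
  have h5 := h4.sub (hasSum_ite_eq (0 : ℤ) (sechPeriod α τ))
  rw [sq]
  refine h5.congr_fun fun m => ?_
  simp

/-- The sum `∑ ε ^ m 2 m / sinh (β m)` over all integers `m ≠ 0`, for a sign `ε`. -/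
noncomputable def corrSum (ε β : ℝ) : ℝ := ∑' m : ℤ, ε ^ m * corr β m

lemma summable_sign_corr {β : ℝ} (hβ : 0 < β) {ε : ℝ} (hε : ε ^ 2 = 1) :
    Summable fun m : ℤ => ε ^ m * corr β m := (hasSum_sign_corr hβ 0 hε).summable

lemma summable_corr {β : ℝ} (hβ : 0 < β) : Summable fun m : ℤ => corr β m := by
  simpa using summable_sign_corr hβ (one_pow 2)

lemma corrSum_eq {α : ℝ} (hα : 0 < α) (τ : ℝ) {ε : ℝ} (hε : ε ^ 2 = 1) :
    corrSum ε α = (∑' k : ℤ, ε ^ k * sech (τ - k * α)) ^ 2 - sechPeriod α τ :=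
  (hasSum_sign_corr hα τ hε).tsum_eq

/-- The alternating sum vanishes at the midpoint of a period. -/
lemma sechPeriod_half {α : ℝ} (hα : 0 < α) : sechPeriod α (α / 2) = -corrSum (-1) α := by
  have h0 : ∑' k : ℤ, (-1 : ℝ) ^ k * sech (α / 2 - k * α) = 0 := by
    -- the substitution `k ↦ 1 - k` changes the sign of every term
    have h := (Equiv.subLeft (1 : ℤ)).tsum_eq fun k : ℤ => (-1 : ℝ) ^ k * sech (α / 2 - k * α)
    have h' : ∀ k : ℤ, (-1 : ℝ) ^ (Equiv.subLeft (1 : ℤ) k) *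
        sech (α / 2 - (Equiv.subLeft (1 : ℤ) k : ℤ) * α)
          = -((-1 : ℝ) ^ k * sech (α / 2 - k * α)) := fun k => by
      rw [Equiv.subLeft_apply, zpow_sub₀ (by norm_num), zpow_one]
      have : α / 2 - ((1 - k : ℤ) : ℝ) * α = -(α / 2 - k * α) := by push_cast; ring
      rw [this, sech_neg, div_eq_mul_inv, ← inv_zpow]
      norm_num
    simp_rw [h', tsum_neg] at h
    linarith
  rw [corrSum_eq hα (α / 2) (by norm_num), h0]
  ring

/-- The periodization is smallest at the midpoint: it differs from its value there by a square. -/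
lemma sechPeriod_half_le {α : ℝ} (hα : 0 < α) (τ : ℝ) :
    sechPeriod α (α / 2) ≤ sechPeriod α τ := by
  rw [sechPeriod_half hα, corrSum_eq hα τ (by norm_num)]
  linarith [sq_nonneg (∑' k : ℤ, (-1 : ℝ) ^ k * sech (τ - k * α))]

lemma sinhRatio_eq {β : ℝ} (hβ : 0 < β) (m : ℤ) :
    sinhRatio (β * m) = β / 2 * corr β m + if m = 0 then 1 else 0 := by
  unfold sinhRatio corr
  by_cases h : m = 0
  · simp [h]
  · have : β * m ≠ 0 := mul_ne_zero hβ.ne' (by exact_mod_cast h)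
    rw [if_neg this, if_neg h]; ring

lemma hasSum_sign_sinhRatio {β : ℝ} (hβ : 0 < β) {ε : ℝ} (hε : ε ^ 2 = 1) :
    HasSum (fun m : ℤ => ε ^ m * sinhRatio (β * m)) (1 + β / 2 * corrSum ε β) := by
  have h := ((summable_sign_corr hβ hε).hasSum.mul_left (β / 2)).add (hasSum_ite_eq (0 : ℤ) (1 : ℝ))
  rw [add_comm] at h
  refine h.congr_fun fun m => ?_
  rw [sinhRatio_eq hβ]
  split_ifs with h
  · simp [h, corr_zero]
  · ring

lemma summable_sinhRatio {β : ℝ} (hβ : 0 < β) : Summable fun m : ℤ => sinhRatio (β * m) := by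
  simpa using (hasSum_sign_sinhRatio hβ (one_pow 2)).summable

/-- **Poisson summation** for `sech²`. -/
lemma poisson_sech_sq {α : ℝ} (hα : 0 < α) (z : ℝ) :
    ((α / 2 * sechPeriod α (α * z) : ℝ) : ℂ) =
      ∑' m : ℤ, (sinhRatio (π ^ 2 / α * m) : ℂ) * Complex.exp (2 * π * Complex.I * m * z) := by
  have hcont : Continuous fun x : ℝ => ((sech (α * x) ^ 2 : ℝ) : ℂ) :=
    Complex.continuous_ofReal.comp
      ((continuous_sech.comp (continuous_const.mul continuous_id)).pow 2)
  have hdecay : (fun x : ℝ => ((sech (α * x) ^ 2 : ℝ) : ℂ)) =O[cocompact ℝ]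
      fun x : ℝ => |x| ^ (-2 : ℝ) := by
    refine Asymptotics.IsBigO.of_bound (4 / α ^ 2) ?_
    have h0 : ∀ᶠ x : ℝ in cocompact ℝ, x ≠ 0 :=
      (isCompact_singleton (x := (0 : ℝ))).compl_mem_cocompact
    filter_upwards [h0] with x hx
    have hx' : 0 < |x| := abs_pos.2 hx
    have h1 : sech (α * x) ≤ 2 / (α * |x|) := by
      refine (sech_le_exp _).trans ?_
      rw [abs_mul, abs_of_pos hα, exp_neg, div_eq_mul_inv]
      gcongr
      linarith [add_one_le_exp (α * |x|)]
    rw [Complex.norm_real, norm_eq_abs, abs_of_nonneg (by positivity), norm_eq_abs,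
      abs_of_nonneg (by positivity), rpow_neg hx'.le, rpow_two]
    calc sech (α * x) ^ 2 ≤ (2 / (α * |x|)) ^ 2 :=
          pow_le_pow_left₀ (sech_pos _).le h1 2
      _ = _ := by field_simp; norm_num
  have hsum : Summable fun m : ℤ => FourierTransform.fourier
      (fun x : ℝ => ((sech (α * x) ^ 2 : ℝ) : ℂ)) (m : ℝ) := by
    simp_rw [fourier_sech_sq hα]
    exact Complex.hasSum_ofReal.2
      ((summable_sinhRatio (by positivity : 0 < π ^ 2 / α)).hasSum.mul_left (2 / α)) |>.summable
  have h := Real.tsum_eq_tsum_fourier_of_rpow_decay_of_summable hcont one_lt_two hdecay hsum z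
  have hl : ∑' k : ℤ, ((sech (α * (z + k)) ^ 2 : ℝ) : ℂ) = (sechPeriod α (α * z) : ℂ) := by
    rw [sechPeriod, ← Complex.ofReal_tsum, ← (Equiv.neg ℤ).tsum_eq]
    congr 2
    funext k
    rw [Equiv.neg_apply]
    push_cast; ring_nf
  rw [hl] at h
  rw [Complex.ofReal_mul, h, ← tsum_mul_left]
  congr 1
  funext m
  rw [fourier_sech_sq hα, fourier_coe_apply]
  have : (α : ℂ) ≠ 0 := by exact_mod_cast hα.ne'
  push_cast
  rw [div_one]
  field_simp

/-- Poisson summation at a point `z` where the characters take the values `ε ^ m`. -/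
lemma poisson_sech_sq_sign {α : ℝ} (hα : 0 < α) {ε z : ℝ} (hε : ε ^ 2 = 1)
    (hz : ∀ m : ℤ, Complex.exp (2 * π * Complex.I * m * z) = (ε ^ m : ℝ)) :
    α / 2 * sechPeriod α (α * z) = 1 + π ^ 2 / α / 2 * corrSum ε (π ^ 2 / α) := by
  have h := poisson_sech_sq hα z
  simp_rw [hz] at h
  rw [← (hasSum_sign_sinhRatio (by positivity : 0 < π ^ 2 / α) hε).tsum_eq]
  apply Complex.ofReal_injective
  rw [h, Complex.ofReal_tsum]
  congr 1
  funext m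
  push_cast; ring

lemma sechPeriod_zero {α : ℝ} (hα : 0 < α) :
    α / 2 * sechPeriod α 0 = 1 + π ^ 2 / α / 2 * corrSum 1 (π ^ 2 / α) := by
  simpa using poisson_sech_sq_sign hα (z := 0) (one_pow 2) fun m => by simp

/-- The functional equation under `α ↦ π² / α` at the midpoint. -/
lemma sechPeriod_half_add {α : ℝ} (hα : 0 < α) :
    α / 2 * sechPeriod α (α / 2) + π ^ 2 / α / 2 * sechPeriod (π ^ 2 / α) (π ^ 2 / α / 2) = 1 := by
  rw [sechPeriod_half (by positivity : 0 < π ^ 2 / α)]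
  have h := poisson_sech_sq_sign hα (ε := -1) (z := 1 / 2) (by norm_num) fun m => by
    have : 2 * (π : ℂ) * Complex.I * m * ((1 / 2 : ℝ) : ℂ) = m * (π * Complex.I) := by
      push_cast; ring
    rw [this, Complex.exp_int_mul, Complex.exp_pi_mul_I]
    push_cast; rfl
  have e : α * (1 / 2) = α / 2 := by ring
  rw [e] at h
  rw [h]; ring

/-- The periodization is largest at `0`, since its Fourier coefficients are positive. -/
lemma sechPeriod_le_zero {α : ℝ} (hα : 0 < α) (τ : ℝ) : sechPeriod α τ ≤ sechPeriod α 0 := by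
  have h := poisson_sech_sq hα (τ / α)
  rw [mul_div_cancel₀ _ hα.ne'] at h
  have h0 := poisson_sech_sq hα 0
  have hs := summable_sinhRatio (by positivity : 0 < π ^ 2 / α)
  have e0 : α / 2 * sechPeriod α 0 = ∑' m : ℤ, sinhRatio (π ^ 2 / α * m) := by
    apply Complex.ofReal_injective
    rw [Complex.ofReal_tsum]
    simpa using h0
  have h1 : α / 2 * sechPeriod α τ ≤ α / 2 * sechPeriod α 0 := by
    rw [e0]
    have hn : ∀ m : ℤ, ‖(sinhRatio (π ^ 2 / α * m) : ℂ) *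
        Complex.exp (2 * π * Complex.I * m * (τ / α : ℝ))‖ =
        sinhRatio (π ^ 2 / α * m) := fun m => by
      have : 2 * (π : ℂ) * Complex.I * m * (τ / α : ℝ) = (2 * π * m * (τ / α) : ℝ) * Complex.I := by
        push_cast; ring
      rw [norm_mul, this, Complex.norm_exp_ofReal_mul_I, mul_one, Complex.norm_real,
        norm_eq_abs, abs_of_pos (sinhRatio_pos _)]
    calc α / 2 * sechPeriod α τ ≤ ‖((α / 2 * sechPeriod α τ : ℝ) : ℂ)‖ := by
          rw [Complex.norm_real]; exact le_abs_self _
      _ ≤ _ := by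
          rw [h]
          refine (norm_tsum_le_tsum_norm ?_).trans ?_
          · simpa only [hn] using hs
          · simp_rw [hn]; exact le_rfl
  exact le_of_mul_le_mul_left h1 (by positivity)

/-! ### Monotonicity and logarithmic convexity of the two building blocks -/

lemma one_sub_exp_le_tanh (y : ℝ) : 1 - 2 * exp (-y) ^ 2 ≤ tanh y := by
  have h1 := exp_pos y
  have h2 := exp_pos (-y)
  have h3 : exp y * exp (-y) = 1 := by rw [← exp_add]; simp
  rw [tanh_eq, le_div_iff₀ (by positivity)]
  nlinarith [mul_pos h2 h2, mul_pos (mul_pos h2 h2) h2]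

lemma half_lt_tanh {y : ℝ} (hy : 1 ≤ y) : 1 / 2 < tanh y := by
  have h := one_sub_exp_le_tanh y
  have h2 : exp (-y) ≤ 1 / 2 := by
    rw [exp_neg, inv_eq_one_div]
    exact one_div_le_one_div_of_le two_pos (by linarith [add_one_le_exp y])
  have h3 := exp_pos (-y)
  rcases eq_or_lt_of_le h2 with h4 | h4
  · have h5 := exp_one_gt_d9
    have h6 : exp y * exp (-y) = 1 := by rw [← exp_add]; simp
    have h7 : exp 1 ≤ exp y := exp_le_exp.2 hy
    rw [h4] at h6
    linarith
  · nlinarith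

lemma strictAntiOn_mul_sech_sq : StrictAntiOn (fun y => y * sech y ^ 2) (Set.Ici 1) := by
  have hd : ∀ y, HasDerivAt (fun y => y * sech y ^ 2) (sech y ^ 2 * (1 - 2 * y * tanh y)) y :=
    fun y => by
      have h : (fun y => y * sech y ^ 2) = fun y => y * (1 - tanh y ^ 2) :=
        funext fun y => by rw [sech_sq]
      rw [h]
      convert! (hasDerivAt_id y).mul (((hasDerivAt_tanh y).pow 2).const_sub 1) using 1
      simp only [id, sech_sq, Pi.pow_apply]
      push_cast; ring
  refine strictAntiOn_of_deriv_neg (convex_Ici 1)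
    (continuous_iff_continuousAt.2 fun y => (hd y).continuousAt).continuousOn fun y hy => ?_
  rw [interior_Ici] at hy
  have hy' : 1 < y := hy
  rw [(hd y).deriv]
  refine mul_neg_of_pos_of_neg (pow_pos (sech_pos y) 2) ?_
  nlinarith [half_lt_tanh hy'.le]

/-- Logarithmic convexity of `y sech² y` beyond `33 / 20`, just to the right of the inflection
point, which lies near `1.6`. -/
lemma strictConvexOn_mul_sech_sq_exp :
    StrictConvexOn ℝ (Set.Ici (log (33 / 20))) (fun u => exp u * sech (exp u) ^ 2) := by
  have hT : ∀ u, HasDerivAt (fun u => tanh (exp u)) ((1 - tanh (exp u) ^ 2) * exp u) u := fun u => by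
    have := (hasDerivAt_tanh (exp u)).comp u (hasDerivAt_exp u)
    rwa [sech_sq] at this
  have h0 : (fun u => exp u * sech (exp u) ^ 2) = fun u => exp u * (1 - tanh (exp u) ^ 2) :=
    funext fun u => by rw [sech_sq]
  have h1 : ∀ u, HasDerivAt (fun u => exp u * (1 - tanh (exp u) ^ 2))
      (exp u * (1 - tanh (exp u) ^ 2) * (1 - 2 * (exp u * tanh (exp u)))) u := fun u => by
    convert! (hasDerivAt_exp u).mul (((hT u).pow 2).const_sub 1) using 1
    simp only [Pi.pow_apply]
    push_cast; ring
  have h2 : ∀ u, HasDerivAt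
      (fun u => exp u * (1 - tanh (exp u) ^ 2) * (1 - 2 * (exp u * tanh (exp u))))
      (exp u * (1 - tanh (exp u) ^ 2) * (1 - 6 * (exp u * tanh (exp u))
        + 6 * (exp u * tanh (exp u)) ^ 2 - 2 * exp u ^ 2)) u := fun u => by
    convert! (h1 u).mul ((((hasDerivAt_exp u).mul (hT u)).const_mul 2).const_sub 1) using 1
    simp only [Pi.mul_apply]
    ring
  rw [h0]
  refine strictConvexOn_of_deriv2_pos (convex_Ici _)
    (continuous_iff_continuousAt.2 fun y => (h1 y).continuousAt).continuousOn fun u hu => ?_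
  rw [interior_Ici] at hu
  have hy : 33 / 20 < exp u := (log_lt_iff_lt_exp (by norm_num)).1 hu
  rw [Function.iterate_succ, Function.iterate_one, Function.comp,
    funext fun u => (h1 u).deriv, (h2 u).deriv]
  set y := exp u
  have hT1 : (92 / 100 : ℝ) ≤ tanh y := by
    refine le_trans ?_ (one_sub_exp_le_tanh y)
    have he : exp (-y) ≤ 1 / 5 := by
      rw [exp_neg, inv_eq_one_div]
      refine one_div_le_one_div_of_le (by norm_num) ?_
      have e1 := exp_one_gt_d9
      have e2 : exp y = exp 1 * exp (y - 1) := by rw [← exp_add]; ring_nf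
      have e3 := quadratic_le_exp_of_nonneg (show 0 ≤ y - 1 by linarith)
      have e4 : (1.86 : ℝ) ≤ exp (y - 1) := by nlinarith
      rw [e2]; nlinarith
    nlinarith [exp_pos (-y)]
  -- the last factor of the second derivative increases in `y tanh y`, which is at least `0.92 y`
  have hw : 92 / 100 * y ≤ y * tanh y := by nlinarith
  refine mul_pos (mul_pos (exp_pos u) (by linarith [tanh_sq_lt_one y])) ?_
  nlinarith

lemma sinh_lt_mul_cosh {y : ℝ} (hy : 0 < y) : sinh y < y * cosh y := by
  have hd : ∀ y, HasDerivAt (fun y => y * cosh y - sinh y) (y * sinh y) y := fun y => by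
    convert! ((hasDerivAt_id y).mul (hasDerivAt_cosh y)).sub (hasDerivAt_sinh y) using 1
    simp
  have : StrictMonoOn (fun y => y * cosh y - sinh y) (Set.Ici 0) := by
    refine strictMonoOn_of_deriv_pos (convex_Ici 0)
      (continuous_iff_continuousAt.2 fun y => (hd y).continuousAt).continuousOn fun y hy => ?_
    rw [interior_Ici] at hy
    rw [(hd y).deriv]
    exact mul_pos hy (sinh_pos_iff.2 hy)
  have := this (Set.mem_Ici.2 le_rfl) (Set.mem_Ici.2 hy.le) hy
  simp at this
  linarith

lemma strictAntiOn_div_sinh : StrictAntiOn (fun y => y / sinh y) (Set.Ioi 0) := by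
  have hd : ∀ y, 0 < y → HasDerivAt (fun y => y / sinh y)
      ((sinh y - y * cosh y) / sinh y ^ 2) y := fun y hy => by
    convert! (hasDerivAt_id y).div (hasDerivAt_sinh y) (sinh_pos_iff.2 hy).ne' using 1
    simp
  refine strictAntiOn_of_deriv_neg (convex_Ioi 0)
    (fun y hy => (hd y hy).continuousAt.continuousWithinAt) fun y hy => ?_
  rw [interior_Ioi] at hy
  rw [(hd y hy).deriv]
  exact div_neg_of_neg_of_pos (by linarith [sinh_lt_mul_cosh hy])
    (pow_pos (sinh_pos_iff.2 hy) 2)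

/-- Logarithmic convexity of `y / sinh y` beyond `3`. -/
lemma strictConvexOn_div_sinh_exp :
    StrictConvexOn ℝ (Set.Ici (log 3)) (fun u => exp u / sinh (exp u)) := by
  have hs0 : ∀ u, sinh (exp u) ≠ 0 := fun u => (sinh_pos_iff.2 (exp_pos u)).ne'
  have hS : ∀ u, HasDerivAt (fun u => sinh (exp u)) (cosh (exp u) * exp u) u := fun u =>
    (hasDerivAt_sinh (exp u)).comp u (hasDerivAt_exp u)
  have hC : ∀ u, HasDerivAt (fun u => cosh (exp u)) (sinh (exp u) * exp u) u := fun u =>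
    (hasDerivAt_cosh (exp u)).comp u (hasDerivAt_exp u)
  have h1 : ∀ u, HasDerivAt (fun u => exp u / sinh (exp u))
      ((exp u * sinh (exp u) - exp u * (cosh (exp u) * exp u)) / sinh (exp u) ^ 2) u := fun u =>
    (hasDerivAt_exp u).div (hS u) (hs0 u)
  have h2 : ∀ u, HasDerivAt
      (fun u => (exp u * sinh (exp u) - exp u * (cosh (exp u) * exp u)) / sinh (exp u) ^ 2)
      (exp u * (sinh (exp u) ^ 2 * (1 + exp u ^ 2) - 3 * exp u * (cosh (exp u) * sinh (exp u))
        + 2 * exp u ^ 2) / sinh (exp u) ^ 3) u := fun u => by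
    convert! (((hasDerivAt_exp u).mul (hS u)).sub ((hasDerivAt_exp u).mul
      ((hC u).mul (hasDerivAt_exp u)))).div ((hS u).pow 2) (pow_ne_zero 2 (hs0 u)) using 1
    have h := hs0 u
    have hc := cosh_sq (exp u)
    simp only [Pi.mul_apply, Pi.sub_apply, Pi.pow_apply]
    rw [div_eq_div_iff (pow_ne_zero 3 h) (pow_ne_zero 2 (pow_ne_zero 2 h))]
    push_cast
    linear_combination (-2 * exp u ^ 3 * sinh (exp u) ^ 4) * hc
  refine strictConvexOn_of_deriv2_pos (convex_Ici _)
    (continuous_iff_continuousAt.2 fun y => (h1 y).continuousAt).continuousOn fun u hu => ?_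
  rw [interior_Ici] at hu
  have hy : 3 < exp u := (log_lt_iff_lt_exp (by norm_num)).1 hu
  rw [Function.iterate_succ, Function.iterate_one, Function.comp,
    funext fun u => (h1 u).deriv, (h2 u).deriv]
  set y := exp u
  have hs := sinh_pos_iff.2 (exp_pos u)
  have hcs : cosh y * sinh y ≤ sinh y ^ 2 + 1 / 2 := by
    have e1 := cosh_sub_sinh y
    have e2 : exp y * exp (-y) = 1 := by rw [← exp_add]; simp
    have e3 := sinh_eq y
    have : (cosh y - sinh y) * sinh y ≤ 1 / 2 := by
      rw [e1, e3]; nlinarith [sq_nonneg (exp (-y))]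
    nlinarith
  refine div_pos (mul_pos (exp_pos u) ?_) (pow_pos hs 3)
  have : 0 < sinh y ^ 2 * (1 + y ^ 2 - 3 * y) := mul_pos (pow_pos hs 2) (by nlinarith)
  nlinarith

/-- A function which is strictly convex in the logarithmic variable lies, at the geometric mean,
strictly below the arithmetic mean of its values. -/
lemma two_mul_lt_of_strictConvexOn_exp {g : ℝ → ℝ} {c : ℝ} (hc : 0 < c)
    (hg : StrictConvexOn ℝ (Set.Ici (log c)) fun u => g (exp u)) {s t : ℝ} (hs : c ≤ s) (ht : c ≤ t)
    (hst : s ≠ t) : 2 * g (√(s * t)) < g s + g t := by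
  have hs0 := hc.trans_le hs
  have ht0 := hc.trans_le ht
  have hs' : log s ∈ Set.Ici (log c) := log_le_log hc hs
  have ht' : log t ∈ Set.Ici (log c) := log_le_log hc ht
  have h := hg.2 hs' ht' (fun h => hst (log_injOn_pos hs0 ht0 h)) (half_pos one_pos)
    (half_pos one_pos) (add_halves 1)
  have e : exp (1 / 2 * log s + 1 / 2 * log t) = √(s * t) := by
    rw [sqrt_eq_rpow, rpow_def_of_pos (mul_pos hs0 ht0), log_mul hs0.ne' ht0.ne']
    ring_nf
  simp only [exp_log hs0, exp_log ht0, smul_eq_mul, e] at h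
  linarith

/-! ### The upper and the lower profile -/

/-- The off-diagonal sum `∑ β m / sinh (β m)` over `m ≠ 0`, which governs the upper frame bound. -/
noncomputable def upperProfile (β : ℝ) : ℝ := β / 2 * corrSum 1 β

/-- The midpoint value `(α / 2) ∑ sech² (α (k + 1 / 2))`, which governs the lower frame bound. -/
noncomputable def lowerProfile (α : ℝ) : ℝ := α / 2 * sechPeriod α (α / 2)

lemma hasSum_upperProfile {β : ℝ} (hβ : 0 < β) :
    HasSum (fun k : ℕ => 2 * (β * (k + 1) / sinh (β * (k + 1)))) (upperProfile β) := by
  have hs := summable_corr hβ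
  have h1 : Summable fun k : ℕ => corr β (k + 1) :=
    hs.comp_injective (i := fun k : ℕ => (k : ℤ) + 1) fun a b h => by simpa using h
  have h2 : corrSum 1 β = 2 * ∑' k : ℕ, corr β (k + 1) := by
    simp only [corrSum, one_zpow, one_mul]
    rw [tsum_of_add_one_of_neg_add_one h1 (by simpa only [corr_neg] using h1)]
    simp only [corr_neg, corr_zero]; ring
  have h3 := h1.hasSum.mul_left β
  have e : upperProfile β = β * ∑' k : ℕ, corr β (k + 1) := by rw [upperProfile, h2]; ring
  rw [e]
  refine h3.congr_fun fun k => ?_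
  simp only [corr]; push_cast; ring

lemma hasSum_lowerProfile {α : ℝ} (hα : 0 < α) :
    HasSum (fun k : ℕ => α * sech (α * (k + 1 / 2)) ^ 2) (lowerProfile α) := by
  have hs : Summable fun k : ℤ => sech (α / 2 + k * α) ^ 2 := by
    refine ((Equiv.neg ℤ).summable_iff.2 (summable_sech_sq hα (α / 2))).congr fun k => ?_
    simp
  have h1 : Summable fun k : ℕ => sech (α / 2 + ((k : ℤ) : ℝ) * α) ^ 2 :=
    hs.comp_injective (i := fun k : ℕ => (k : ℤ)) Nat.cast_injective
  have hneg : ∀ k : ℕ, sech (α / 2 + ((-((k : ℤ) + 1) : ℤ) : ℝ) * α) ^ 2 =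
      sech (α / 2 + ((k : ℤ) : ℝ) * α) ^ 2 := fun k => by
    rw [← sech_neg]; push_cast; ring_nf
  have h2 : sechPeriod α (α / 2) = 2 * ∑' k : ℕ, sech (α / 2 + ((k : ℤ) : ℝ) * α) ^ 2 := by
    rw [sechPeriod, ← (Equiv.neg ℤ).tsum_eq]
    have : ∀ k : ℤ, sech (α / 2 - ((Equiv.neg ℤ k : ℤ) : ℝ) * α) ^ 2 =
        sech (α / 2 + (k : ℝ) * α) ^ 2 := fun k => by simp
    simp_rw [this]
    rw [tsum_of_nat_of_neg_add_one (f := fun k : ℤ => sech (α / 2 + (k : ℝ) * α) ^ 2) h1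
      (by simpa only [hneg] using h1)]
    simp_rw [hneg]; ring
  have h3 := h1.hasSum.mul_left α
  have e : lowerProfile α = α * ∑' k : ℕ, sech (α / 2 + ((k : ℤ) : ℝ) * α) ^ 2 := by
    rw [lowerProfile, h2]; ring
  rw [e]
  refine h3.congr_fun fun k => ?_
  push_cast; ring_nf

lemma upperProfile_nonneg {β : ℝ} (hβ : 0 < β) : 0 ≤ upperProfile β :=
  (hasSum_upperProfile hβ).nonneg fun k => by
    have : 0 < β * (k + 1) := by positivity
    have := sinh_pos_iff.2 this
    positivity

lemma lowerProfile_nonneg {α : ℝ} (hα : 0 < α) : 0 ≤ lowerProfile α :=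
  (hasSum_lowerProfile hα).nonneg fun k => by positivity

/-- The lower profile is, up to sign, the alternating version of the series of the upper profile. -/
lemma lowerProfile_le_upperProfile {β : ℝ} (hβ : 0 < β) : lowerProfile β ≤ upperProfile β := by
  rw [lowerProfile, upperProfile, sechPeriod_half hβ]
  gcongr
  rw [corrSum, corrSum, ← tsum_neg]
  refine Summable.tsum_le_tsum (fun m => ?_) (summable_sign_corr hβ (by norm_num)).neg
    (summable_sign_corr hβ (one_pow 2))
  rw [one_zpow, one_mul]
  have h : |(-1 : ℝ) ^ m * corr β m| = corr β m := by
    rw [abs_mul, abs_zpow]; simp [abs_of_nonneg (corr_nonneg hβ m)]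
  linarith [neg_abs_le ((-1 : ℝ) ^ m * corr β m)]

lemma upperProfile_antitone {s t : ℝ} (hs : 0 < s) (hst : s ≤ t) :
    upperProfile t ≤ upperProfile s := by
  refine hasSum_le (fun k => ?_) (hasSum_upperProfile (hs.trans_le hst)) (hasSum_upperProfile hs)
  have : s * (k + 1) ≤ t * (k + 1) := by gcongr
  have := strictAntiOn_div_sinh.antitoneOn (Set.mem_Ioi.2 (by positivity))
    (Set.mem_Ioi.2 (by have := hs.trans_le hst; positivity)) this
  linarith

lemma lowerProfile_lt_of_two_le {s t : ℝ} (hs : 2 ≤ s) (hst : s < t) :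
    lowerProfile t < lowerProfile s := by
  have key : ∀ k : ℕ, t * sech (t * (k + 1 / 2)) ^ 2 < s * sech (s * (k + 1 / 2)) ^ 2 := fun k => by
    have hk : (0 : ℝ) ≤ k := k.cast_nonneg
    have h := strictAntiOn_mul_sech_sq (a := s * (k + 1 / 2)) (b := t * (k + 1 / 2))
      (Set.mem_Ici.2 (by nlinarith)) (Set.mem_Ici.2 (by nlinarith))
      (mul_lt_mul_of_pos_right hst (by positivity))
    simp only at h
    have e : (0 : ℝ) < k + 1 / 2 := by positivity
    nlinarith
  exact hasSum_lt (fun k => (key k).le) (key 0) (hasSum_lowerProfile (by linarith))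
    (hasSum_lowerProfile (by linarith))

lemma lowerProfile_add {α : ℝ} (hα : 0 < α) : lowerProfile α + lowerProfile (π ^ 2 / α) = 1 :=
  sechPeriod_half_add hα

lemma lowerProfile_pi : lowerProfile π = 1 / 2 := by
  have h := lowerProfile_add pi_pos
  rw [sq, mul_div_assoc, div_self pi_ne_zero, mul_one] at h
  linarith

/-- Beyond `π` the terms of the series decrease; below `π` the functional equation applies. -/
lemma lowerProfile_strictAnti {s t : ℝ} (hs : 0 < s) (hst : s < t) :
    lowerProfile t < lowerProfile s := by
  have hpi := pi_gt_three
  have ht := hs.trans hst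
  have refl : ∀ {α}, 0 < α → α < π → π < π ^ 2 / α := fun h1 h2 => by
    rw [lt_div_iff₀ h1]; nlinarith
  rcases le_or_gt π s with h | h
  · exact lowerProfile_lt_of_two_le (by linarith) hst
  have h1 : 1 / 2 < lowerProfile s := by
    have := lowerProfile_lt_of_two_le (by linarith) (refl hs h)
    rw [lowerProfile_pi] at this
    linarith [lowerProfile_add hs]
  rcases le_or_gt π t with h' | h'
  · rcases eq_or_lt_of_le h' with rfl | h'
    · rwa [lowerProfile_pi]
    · have := lowerProfile_lt_of_two_le (by linarith) h'
      rw [lowerProfile_pi] at this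
      linarith
  · have := lowerProfile_lt_of_two_le (s := π ^ 2 / t) (t := π ^ 2 / s)
      (by linarith [refl ht h']) (by gcongr)
    linarith [lowerProfile_add hs, lowerProfile_add ht]

lemma upperProfile_convex {s t : ℝ} (hs : 3 ≤ s) (ht : 3 ≤ t) (hst : s ≠ t) :
    2 * upperProfile (√(s * t)) < upperProfile s + upperProfile t := by
  have hs0 : 0 < s := by linarith
  have ht0 : 0 < t := by linarith
  have key : ∀ k : ℕ, 2 * (2 * (√(s * t) * (k + 1) / sinh (√(s * t) * (k + 1)))) <
      2 * (s * (k + 1) / sinh (s * (k + 1))) + 2 * (t * (k + 1) / sinh (t * (k + 1))) := fun k => by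
    have hk : (0 : ℝ) ≤ k := k.cast_nonneg
    have h := two_mul_lt_of_strictConvexOn_exp (g := fun y => y / sinh y) three_pos
      strictConvexOn_div_sinh_exp
      (s := s * (k + 1)) (t := t * (k + 1)) (by nlinarith) (by nlinarith)
      (fun h => hst (mul_right_cancel₀ (by positivity) h))
    have e : √(s * (k + 1) * (t * (k + 1))) = √(s * t) * (k + 1) := by
      rw [show s * (k + 1) * (t * (k + 1)) = s * t * (k + 1) ^ 2 by ring, sqrt_mul (by positivity),
        sqrt_sq (by positivity)]
    simp only [e] at h
    linarith
  exact hasSum_lt (fun k => (key k).le) (key 0)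
    ((hasSum_upperProfile (sqrt_pos.2 (mul_pos hs0 ht0))).mul_left 2)
    ((hasSum_upperProfile hs0).add (hasSum_upperProfile ht0))

lemma lowerProfile_convex {s t : ℝ} (hs : 33 / 10 ≤ s) (ht : 33 / 10 ≤ t) (hst : s ≠ t) :
    2 * lowerProfile (√(s * t)) < lowerProfile s + lowerProfile t := by
  have hs0 : 0 < s := by linarith
  have ht0 : 0 < t := by linarith
  have key : ∀ k : ℕ, 2 * (√(s * t) * sech (√(s * t) * (k + 1 / 2)) ^ 2) <
      s * sech (s * (k + 1 / 2)) ^ 2 + t * sech (t * (k + 1 / 2)) ^ 2 := fun k => by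
    have hk : (0 : ℝ) ≤ k := k.cast_nonneg
    have hk' : (0 : ℝ) < k + 1 / 2 := by positivity
    have h := two_mul_lt_of_strictConvexOn_exp (g := fun y => y * sech y ^ 2)
      (by norm_num) strictConvexOn_mul_sech_sq_exp
      (s := s * (k + 1 / 2)) (t := t * (k + 1 / 2)) (by nlinarith) (by nlinarith)
      (fun h => hst (mul_right_cancel₀ hk'.ne' h))
    have e : √(s * (k + 1 / 2) * (t * (k + 1 / 2))) = √(s * t) * (k + 1 / 2) := by
      rw [show s * (k + 1 / 2) * (t * (k + 1 / 2)) = s * t * (k + 1 / 2) ^ 2 by ring,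
        sqrt_mul (by positivity), sqrt_sq hk'.le]
    simp only [e] at h
    refine lt_of_mul_lt_mul_right ?_ hk'.le
    linarith
  exact hasSum_lt (fun k => (key k).le) (key 0)
    ((hasSum_lowerProfile (sqrt_pos.2 (mul_pos hs0 ht0))).mul_left 2)
    ((hasSum_lowerProfile hs0).add (hasSum_lowerProfile ht0))

/-! ### Numerical comparison away from the diagonal -/

-- `111 / 25 = 4.44` lies just below `π √2`, the smallest possible value of `π √n`.

lemma exp_neg_444_le : exp (-(111 / 25)) ≤ 1 / 83 := by
  rw [exp_neg, inv_eq_one_div]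
  refine one_div_le_one_div_of_le (by norm_num) ?_
  have e1 := exp_one_gt_d9
  have e2 : exp (111 / 25) = exp 1 ^ 4 * exp (11 / 25) := by
    rw [← exp_nat_mul, ← exp_add]; norm_num
  have e3 := quadratic_le_exp_of_nonneg (show (0 : ℝ) ≤ 11 / 25 by norm_num)
  have e4 : (2.7182 : ℝ) ^ 4 ≤ exp 1 ^ 4 := pow_le_pow_left₀ (by norm_num) (by linarith) 4
  rw [e2]
  calc (83 : ℝ) ≤ 2.7182 ^ 4 * (1 + 11 / 25 + (11 / 25) ^ 2 / 2) := by norm_num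
    _ ≤ _ := by gcongr

lemma upperProfile_444_le : upperProfile (111 / 25) ≤ 0.2195 := by
  set E := exp (-(111 / 25)) with hE
  have hE0 : 0 < E := exp_pos _
  have hE1 : E ≤ 1 / 83 := exp_neg_444_le
  have hg : HasSum (fun k : ℕ => ((k + 1 : ℕ) : ℝ) * E ^ (k + 1)) (E / (1 - E) ^ 2) := by
    have h := hasSum_coe_mul_geometric_of_norm_lt_one (r := E)
      (by rw [norm_eq_abs, abs_of_pos hE0]; linarith)
    rw [← hasSum_nat_add_iff' 1] at h
    simpa using h
  have hg2 := hg.mul_left (4 * (111 / 25) / (1 - E ^ 2))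
  have hE2 : 0 < 1 - E ^ 2 := by nlinarith
  have hle : upperProfile (111 / 25) ≤ 4 * (111 / 25) / (1 - E ^ 2) * (E / (1 - E) ^ 2) := by
    refine hasSum_le (fun k => ?_) (hasSum_upperProfile (by norm_num)) hg2
    have e1 : exp (-(111 / 25 * ((k : ℝ) + 1))) = E ^ (k + 1) := by
      rw [hE, ← exp_nat_mul]; push_cast; ring_nf
    have e2 : exp (111 / 25 * ((k : ℝ) + 1)) = (E ^ (k + 1))⁻¹ := by
      rw [← e1, exp_neg, inv_inv]
    have hpow : 0 < E ^ (k + 1) := by positivity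
    have hpow1 : E ^ (k + 1) ≤ E := by
      rw [pow_succ]
      have : E ^ k ≤ 1 := pow_le_one₀ hE0.le (by linarith)
      nlinarith
    have hsinh : (1 - E ^ 2) / (2 * E ^ (k + 1)) ≤ sinh (111 / 25 * ((k : ℝ) + 1)) := by
      rw [sinh_eq, e1, e2, div_le_iff₀ (by positivity)]
      have : ((E ^ (k + 1))⁻¹ - E ^ (k + 1)) / 2 * (2 * E ^ (k + 1)) = 1 - (E ^ (k + 1)) ^ 2 := by
        field_simp
      rw [this]
      nlinarith
    calc 2 * (111 / 25 * ((k : ℝ) + 1) / sinh (111 / 25 * ((k : ℝ) + 1)))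
        ≤ 2 * (111 / 25 * ((k : ℝ) + 1) / ((1 - E ^ 2) / (2 * E ^ (k + 1)))) := by gcongr
      _ = _ := by push_cast; field_simp; norm_num
  refine hle.trans ?_
  have h1 : (1 - 1 / 83 : ℝ) ^ 2 ≤ (1 - E) ^ 2 := pow_le_pow_left₀ (by norm_num) (by linarith) 2
  have h2 : (1 - (1 / 83) ^ 2 : ℝ) ≤ 1 - E ^ 2 := by nlinarith
  calc 4 * (111 / 25) / (1 - E ^ 2) * (E / (1 - E) ^ 2)
      ≤ 4 * (111 / 25) / (1 - (1 / 83) ^ 2) * ((1 / 83) / (1 - 1 / 83) ^ 2) := by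
        gcongr
    _ ≤ 0.2195 := by norm_num

lemma upperProfile_three_gt : 0.59 < upperProfile 3 := by
  have h : (2 * (3 * ((0 : ℕ) + 1 : ℝ) / sinh (3 * ((0 : ℕ) + 1)))) ≤ upperProfile 3 :=
    le_hasSum (hasSum_upperProfile three_pos) 0 fun k _ => by
      have : (0 : ℝ) < 3 * (k + 1) := by positivity
      have := sinh_pos_iff.2 this
      positivity
  refine lt_of_lt_of_le ?_ h
  have h3 := sinh_pos_iff.2 (three_pos (α := ℝ))
  have e1 : exp 3 = exp 1 ^ 3 := by rw [← exp_nat_mul]; norm_num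
  have e2 : exp 1 ^ 3 ≤ 2.7183 ^ 3 :=
    pow_le_pow_left₀ (exp_pos 1).le (by linarith [exp_one_lt_d9]) 3
  have e3 : sinh 3 ≤ 10.05 := by
    rw [sinh_eq, e1]
    have := exp_pos (-3)
    norm_num at e2 ⊢
    linarith
  norm_num
  rw [mul_div_assoc', lt_div_iff₀ h3]
  linarith

lemma lowerProfile_33_gt : 0.446 < lowerProfile (33 / 10) := by
  have h : (33 / 10 : ℝ) * sech (33 / 10 * ((0 : ℕ) + 1 / 2)) ^ 2 ≤ lowerProfile (33 / 10) :=
    le_hasSum (hasSum_lowerProfile (by norm_num)) 0 fun k _ => by positivity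
  refine lt_of_lt_of_le ?_ h
  have e0 : (33 / 10 * ((0 : ℕ) + 1 / 2) : ℝ) = 33 / 20 := by norm_num
  rw [e0]
  have e1 := exp_one_gt_d9
  have e2 := exp_one_lt_d9
  have hup : exp (33 / 20) ≤ 5.24 := by
    have a1 : exp (33 / 20) * exp (7 / 20) = exp 1 ^ 2 := by
      rw [← exp_nat_mul, ← exp_add]; norm_num
    have a2 := quadratic_le_exp_of_nonneg (show (0 : ℝ) ≤ 7 / 20 by norm_num)
    have a3 := exp_pos (33 / 20)
    nlinarith
  have hlo : exp (-(33 / 20)) ≤ 0.198 := by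
    have a1 : exp (33 / 20) = exp 1 * exp (13 / 20) := by
      rw [← exp_add]; norm_num
    have a2 := quadratic_le_exp_of_nonneg (show (0 : ℝ) ≤ 13 / 20 by norm_num)
    have a3 : 5.0592 ≤ exp (33 / 20) := by rw [a1]; nlinarith
    rw [exp_neg]
    refine (inv_anti₀ (by norm_num) a3).trans (by norm_num)
  have hc : cosh (33 / 20) ≤ 2.72 := by rw [cosh_eq]; linarith
  have hs : 1 / 2.72 ≤ sech (33 / 20) := one_div_le_one_div_of_le (cosh_pos _) hc
  calc (0.446 : ℝ) < 33 / 10 * (1 / 2.72) ^ 2 := by norm_num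
    _ ≤ _ := by gcongr

lemma le_pi_mul_sqrt {n : ℕ} (hn : 2 ≤ n) : 111 / 25 ≤ π * √n := by
  have h1 := pi_gt_d4
  have h2 : (1.4142 : ℝ) ≤ √n := by
    refine le_sqrt_of_sq_le ?_
    have : (2 : ℝ) ≤ n := by exact_mod_cast hn
    linarith
  nlinarith

/-- A sum `F s + F t` with `s t = r ^ 2` is smallest at `s = t = r`, if `F` is midpoint convex in the
logarithmic variable beyond `c`, and exceeds `2 F r` below `c`. -/
lemma two_mul_lt_add_of_convex_of_low {F : ℝ → ℝ} {c r : ℝ} (hr : 0 < r)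
    (hconv : ∀ {s t}, c ≤ s → c ≤ t → s ≠ t → 2 * F (√(s * t)) < F s + F t)
    (hpos : ∀ {s}, 0 < s → 0 ≤ F s) (hlow : ∀ {s}, 0 < s → s < c → 2 * F r < F s)
    {s t : ℝ} (hs : 0 < s) (hst : s * t = r ^ 2) (hne : s ≠ r) : 2 * F r < F s + F t := by
  have ht : 0 < t := pos_of_mul_pos_right (by rw [hst]; positivity) hs.le
  rcases lt_or_ge s c with h1 | h1
  · linarith [hlow hs h1, hpos ht]
  rcases lt_or_ge t c with h2 | h2
  · linarith [hlow ht h2, hpos hs]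
  have := hconv h1 h2 fun h => hne (by
    subst h
    exact (pow_left_inj₀ hs.le hr.le two_ne_zero).1 (by rw [← hst, sq]))
  rwa [hst, sqrt_sq hr.le] at this

lemma upperProfile_lt_add {n : ℕ} (hn : 2 ≤ n) {s t : ℝ} (hs : 0 < s)
    (hst : s * t = (π * √n) ^ 2) (hne : s ≠ π * √n) :
    2 * upperProfile (π * √n) < upperProfile s + upperProfile t := by
  have hr := le_pi_mul_sqrt hn
  refine two_mul_lt_add_of_convex_of_low (c := 3) (by linarith) upperProfile_convex
    upperProfile_nonneg (fun h0 h3 => ?_) hs hst hne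
  have h1 := upperProfile_antitone (by norm_num) hr
  have h2 := upperProfile_antitone h0 h3.le
  linarith [upperProfile_444_le, upperProfile_three_gt]

lemma lowerProfile_lt_add {n : ℕ} (hn : 2 ≤ n) {s t : ℝ} (hs : 0 < s)
    (hst : s * t = (π * √n) ^ 2) (hne : s ≠ π * √n) :
    2 * lowerProfile (π * √n) < lowerProfile s + lowerProfile t := by
  have hr := le_pi_mul_sqrt hn
  refine two_mul_lt_add_of_convex_of_low (c := 33 / 10) (by linarith) lowerProfile_convex
    lowerProfile_nonneg (fun h0 h3 => ?_) hs hst hne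
  have h1 := upperProfile_antitone (by norm_num) hr
  have h2 := lowerProfile_strictAnti h0 h3
  have h3 := lowerProfile_le_upperProfile (show 0 < π * √n by linarith)
  linarith [upperProfile_444_le, lowerProfile_33_gt]

/-! ### Integrals over the line as integrals over one cell -/

lemma pairwise_disjoint_cells {T : ℝ} (hT : 0 < T) :
    Pairwise (Function.onFun Disjoint fun j : ℤ => Set.Ioc (j * T) (j * T + T)) := fun i j hij => by
  refine Set.disjoint_left.2 fun t hi hj => hij ?_
  have h1 : (i : ℝ) < j + 1 := by
    have := hi.1.trans_le hj.2
    nlinarith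
  have h2 : (j : ℝ) < i + 1 := by
    have := hj.1.trans_le hi.2
    nlinarith
  have h1' : i < j + 1 := by exact_mod_cast h1
  have h2' : j < i + 1 := by exact_mod_cast h2
  omega

lemma integral_cells {T : ℝ} (hT : 0 < T) {S : Finset ℤ} {Φ : ℝ → ℂ} (hΦ : Integrable Φ)
    (hS : ∀ t, Φ t ≠ 0 → ∃ j ∈ S, t ∈ Set.Ioc (j * T) (j * T + T)) :
    ∫ t, Φ t = ∫ t in (0 : ℝ)..T, ∑ j ∈ S, Φ (t + j * T) := by
  have h1 : ∫ t, Φ t = ∫ t in ⋃ j ∈ S, Set.Ioc ((j : ℝ) * T) (j * T + T), Φ t := by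
    refine (setIntegral_eq_integral_of_forall_compl_eq_zero fun t ht => ?_).symm
    by_contra h
    obtain ⟨j, hj, hjt⟩ := hS t h
    exact ht (Set.mem_biUnion hj hjt)
  rw [h1, integral_biUnion_finset S (fun _ _ => measurableSet_Ioc)
    (fun i _ j _ hij => pairwise_disjoint_cells hT hij) fun _ _ => hΦ.integrableOn,
    intervalIntegral.integral_finsetSum (f := fun (j : ℤ) t => Φ (t + j * T)) fun j _ =>
      (hΦ.comp_add_right (j * T)).intervalIntegrable]
  refine Finset.sum_congr rfl fun j _ => ?_
  rw [intervalIntegral.integral_comp_add_right, zero_add, add_comm T,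
    intervalIntegral.integral_of_le (by linarith)]

lemma lintegral_cells {T : ℝ} (hT : 0 < T) {S : Finset ℤ} {Φ : ℝ → ℝ≥0∞} (hΦ : AEMeasurable Φ)
    (hS : ∀ t, Φ t ≠ 0 → ∃ j ∈ S, t ∈ Set.Ioc (j * T) (j * T + T)) :
    ∫⁻ t, Φ t = ∫⁻ t in Set.Ioc 0 T, ∑ j ∈ S, Φ (t + j * T) := by
  have hm : MeasurableSet (⋃ j ∈ S, Set.Ioc ((j : ℝ) * T) (j * T + T)) :=
    Finset.measurableSet_biUnion S fun _ _ => measurableSet_Ioc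
  have h1 : ∫⁻ t, Φ t = ∫⁻ t in ⋃ j ∈ S, Set.Ioc ((j : ℝ) * T) (j * T + T), Φ t := by
    rw [← lintegral_indicator hm]
    congr 1
    funext t
    refine (Set.indicator_apply_eq_self.2 fun ht => ?_).symm
    by_contra h
    obtain ⟨j, hj, hjt⟩ := hS t h
    exact ht (Set.mem_biUnion hj hjt)
  rw [h1, lintegral_biUnion_finset (fun i _ j _ hij => pairwise_disjoint_cells hT hij)
    (fun _ _ => measurableSet_Ioc), lintegral_finsetSum']
  · refine Finset.sum_congr rfl fun j _ => ?_
    have hp := (measurePreserving_add_right (volume : Measure ℝ) ((j : ℝ) * T)).setLIntegral_comp_emb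
      (MeasurableEquiv.addRight ((j : ℝ) * T)).measurableEmbedding Φ (Set.Ioc 0 T)
    rw [hp]
    congr 2
    simp [add_comm]
  · exact fun j _ => (hΦ.comp_quasiMeasurePreserving
      (measurePreserving_add_right volume ((j : ℝ) * T)).quasiMeasurePreserving).restrict

/-! ### The Gabor sum of a function supported in finitely many cells -/

lemma continuous_sechWindow (γ : ℝ) : Continuous (sechWindow γ) := by
  unfold sechWindow
  exact Complex.continuous_ofReal.comp (continuous_const.mul
    (continuous_sech.comp ((continuous_const.mul continuous_id).div_const γ)))

lemma sech_sq_le (x : ℝ) : sech x ^ 2 ≤ (1 + x ^ 2)⁻¹ := by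
  have h1 : x ^ 2 ≤ sinh x ^ 2 := by
    rw [← sq_abs x, ← sq_abs (sinh x)]
    refine pow_le_pow_left₀ (abs_nonneg x) ?_ 2
    rw [abs_sinh]
    exact self_le_sinh_iff.2 (abs_nonneg x)
  rw [sech, div_pow, one_pow, one_div]
  refine inv_anti₀ (by positivity) ?_
  rw [cosh_sq x]; linarith

lemma memLp_sech : MemLp (fun t => (sech t : ℂ)) 2 := by
  have hc : Continuous fun t : ℝ => (sech t : ℂ) := Complex.continuous_ofReal.comp continuous_sech
  rw [memLp_two_iff_integrable_sq_norm hc.aestronglyMeasurable]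
  refine integrable_inv_one_add_sq.mono'
    (hc.norm.pow 2).aestronglyMeasurable
    (ae_of_all _ fun t => ?_)
  rw [norm_eq_abs, abs_of_nonneg (by positivity), Complex.norm_real, norm_eq_abs, sq_abs]
  exact sech_sq_le t

lemma memLp_sechWindow {γ : ℝ} (hγ : 0 < γ) : MemLp (sechWindow γ) 2 := by
  have h1 : MemLp (fun t => (sech (π / γ * t) : ℂ)) 2 := by
    have hc : Continuous fun t : ℝ => (sech (π / γ * t) : ℂ) := Complex.continuous_ofReal.comp
      (continuous_sech.comp (continuous_const.mul continuous_id))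
    rw [memLp_two_iff_integrable_sq_norm hc.aestronglyMeasurable]
    have := (memLp_two_iff_integrable_sq_norm memLp_sech.1).1 memLp_sech
    exact this.comp_mul_left' (by positivity)
  refine (h1.const_mul ((√(π / (2 * γ)) : ℝ) : ℂ)).ae_eq (ae_of_all _ fun t => ?_)
  simp only [sechWindow]
  rw [div_mul_eq_mul_div]
  push_cast; rfl

lemma memLp_timeFreqShift {g : ℝ → ℂ} (hg : MemLp g 2) (l : ℝ × ℝ) :
    MemLp (timeFreqShift l g) 2 := by
  have h1 : MemLp (fun t => g (t - l.1)) 2 :=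
    hg.comp_measurePreserving (measurePreserving_sub_right volume l.1)
  have hc : Continuous fun t : ℝ => Complex.exp (2 * π * Complex.I * l.2 * t) := by fun_prop
  refine h1.of_le (h1.1.mul hc.aestronglyMeasurable) (ae_of_all _ fun t => ?_)
  have : 2 * (π : ℂ) * Complex.I * l.2 * t = (2 * π * l.2 * t : ℝ) * Complex.I := by
    push_cast; ring
  rw [timeFreqShift, norm_mul, this, Complex.norm_exp_ofReal_mul_I, mul_one]

lemma stft_eq_inner {g : ℝ → ℂ} (hg : MemLp g 2) (f : Lp ℂ 2 (volume : Measure ℝ)) (l : ℝ × ℝ) :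
    stft g f l = inner ℂ ((memLp_timeFreqShift hg l).toLp) f := by
  rw [L2.inner_def, stft]
  refine integral_congr_ae ?_
  filter_upwards [(memLp_timeFreqShift hg l).coeFn_toLp] with t ht
  rw [ht]; rfl

lemma stft_sub {g : ℝ → ℂ} (hg : MemLp g 2) (f h : Lp ℂ 2 (volume : Measure ℝ)) (l : ℝ × ℝ) :
    stft g (f - h) l = stft g f l - stft g h l := by
  simp_rw [stft_eq_inner hg, inner_sub_right]

lemma continuous_stft {g : ℝ → ℂ} (hg : MemLp g 2) (l : ℝ × ℝ) :
    Continuous fun f : Lp ℂ 2 (volume : Measure ℝ) => stft g f l := by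
  simp_rw [stft_eq_inner hg]
  fun_prop

lemma gaborSum_eq_tsum_tsum (g : ℝ → ℂ) {a b : ℝ} (ha : a ≠ 0) (hb : b ≠ 0)
    (f : Lp ℂ 2 (volume : Measure ℝ)) :
    gaborSum g (rectLattice a b) f = ∑' k : ℤ, ∑' l : ℤ, ‖stft g f (k * a, l * b)‖ₑ ^ 2 := by
  let e : ℤ × ℤ → rectLattice a b := fun p => ⟨(p.1 * a, p.2 * b),
    AddSubgroup.mem_prod.2 ⟨⟨p.1, by simp⟩, ⟨p.2, by simp⟩⟩⟩
  have he : Function.Bijective e := by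
    constructor
    · rintro ⟨k, l⟩ ⟨k', l'⟩ h
      have h' := congrArg Subtype.val h
      simp only [e, Prod.mk.injEq, mul_eq_mul_right_iff, ha, hb, or_false, Int.cast_inj] at h'
      rw [h'.1, h'.2]
    · rintro ⟨⟨x, y⟩, h⟩
      obtain ⟨⟨k, hk⟩, ⟨l, hl⟩⟩ := AddSubgroup.mem_prod.1 h
      refine ⟨(k, l), Subtype.ext ?_⟩
      simp only [zsmul_eq_mul] at hk hl
      simp [e, hk, hl]
  rw [gaborSum, ← (Equiv.ofBijective e he).tsum_eq, ENNReal.tsum_prod']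
  rfl

/-- Parseval on a cell of length `T`, for the exponentials of frequency `ℤ / T`. -/
lemma tsum_enorm_sq_integral {T : ℝ} (hT : 0 < T) {H : ℝ → ℂ}
    (hH : MemLp H 2 (volume.restrict (Set.Ioc 0 T))) :
    ∑' l : ℤ, ‖∫ t in (0 : ℝ)..T, H t * Complex.exp (-(2 * π * Complex.I * (l / T) * t))‖ₑ ^ 2 =
      ENNReal.ofReal T * ∫⁻ t in Set.Ioc 0 T, ‖H t‖ₑ ^ 2 := by
  have hP := hasSum_sq_fourierCoeffOn hT hH
  have hc : ∀ l : ℤ, fourierCoeffOn hT H l =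
      (T⁻¹ : ℝ) • ∫ t in (0 : ℝ)..T, H t * Complex.exp (-(2 * π * Complex.I * (l / T) * t)) :=
    fun l => by
      rw [fourierCoeffOn_eq_integral]
      simp only [sub_zero, one_div]
      congr 1
      refine intervalIntegral.integral_congr fun t _ => ?_
      simp only [smul_eq_mul]
      rw [fourier_coe_apply, mul_comm]
      congr 2
      push_cast; ring
  simp_rw [hc, norm_smul, mul_pow, sub_zero] at hP
  have hP2 := hP.mul_left (T ^ 2)
  have e1 : ∀ x : ℝ, T ^ 2 * (‖T⁻¹‖ ^ 2 * x) = x := fun x => by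
    rw [norm_eq_abs, sq_abs]; field_simp
  simp_rw [e1] at hP2
  have e2 : T ^ 2 * (T⁻¹ • ∫ t in (0 : ℝ)..T, ‖H t‖ ^ 2) = T * ∫ t in Set.Ioc 0 T, ‖H t‖ ^ 2 := by
    rw [intervalIntegral.integral_of_le hT.le, smul_eq_mul]; field_simp
  rw [e2] at hP2
  have e3 : ∀ z : ℂ, ‖z‖ₑ ^ 2 = ENNReal.ofReal (‖z‖ ^ 2) := fun z => by
    rw [ENNReal.ofReal_pow (norm_nonneg z), ofReal_norm]
  simp_rw [e3]
  rw [← ENNReal.ofReal_tsum_of_nonneg (fun l => by positivity) hP2.summable, hP2.tsum_eq,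
    ENNReal.ofReal_mul hT.le, ofReal_integral_eq_lintegral_ofReal
      ((memLp_two_iff_integrable_sq_norm hH.1).1 hH) (ae_of_all _ fun t => by positivity)]

/-- The fibres of `f` against the translate of the window by `k a`. -/
lemma tsum_stft_eq {g : ℝ → ℂ} (hg : MemLp g 2) (hgc : Continuous g) {M : ℝ}
    (hgM : ∀ t, ‖g t‖ ≤ M) {T : ℝ} (hT : 0 < T) {S : Finset ℤ} {F : ℝ → ℂ} (hF : MemLp F 2)
    (hS : ∀ t, F t ≠ 0 → ∃ j ∈ S, t ∈ Set.Ioc (j * T) (j * T + T)) (x : ℝ) :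
    ∑' l : ℤ, ‖stft g hF.toLp (x, l * T⁻¹)‖ₑ ^ 2 = ENNReal.ofReal T *
      ∫⁻ t in Set.Ioc 0 T, ‖∑ j ∈ S, F (t + j * T) * starRingEnd ℂ (g (t + j * T - x))‖ₑ ^ 2 := by
  have hH : MemLp (fun t => ∑ j ∈ S, F (t + j * T) * starRingEnd ℂ (g (t + j * T - x))) 2 := by
    refine memLp_finsetSum S fun j _ => ?_
    have h1 : MemLp (fun t => F (t + j * T)) 2 :=
      hF.comp_measurePreserving (measurePreserving_add_right volume ((j : ℝ) * T))
    have hc : Continuous fun t : ℝ => starRingEnd ℂ (g (t + j * T - x)) :=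
      Complex.continuous_conj.comp (hgc.comp (by fun_prop))
    refine h1.of_le_mul (c := M) (h1.1.mul hc.aestronglyMeasurable) (ae_of_all _ fun t => ?_)
    rw [norm_mul, RCLike.norm_conj, mul_comm]
    exact mul_le_mul_of_nonneg_right (hgM _) (norm_nonneg _)
  rw [← tsum_enorm_sq_integral hT (hH.mono_measure Measure.restrict_le_self)]
  congr 1
  funext l
  congr 2
  have h2 : stft g hF.toLp (x, l * T⁻¹) =
      ∫ t, F t * starRingEnd ℂ (timeFreqShift (x, l * T⁻¹) g t) := by
    refine integral_congr_ae ?_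
    filter_upwards [hF.coeFn_toLp] with t ht
    rw [ht]
  have hint : Integrable fun t => F t * starRingEnd ℂ (timeFreqShift (x, l * T⁻¹) g t) :=
    hF.integrable_mul (memLp_timeFreqShift hg _).star
  rw [h2, integral_cells hT hint fun t ht => hS t (left_ne_zero_of_mul ht)]
  refine intervalIntegral.integral_congr fun t _ => ?_
  simp only [Finset.sum_mul]
  refine Finset.sum_congr rfl fun j _ => ?_
  rw [timeFreqShift, map_mul, ← mul_assoc]
  congr 1
  rw [← Complex.exp_conj]
  have hTc : (T : ℂ) ≠ 0 := by exact_mod_cast hT.ne'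
  have e : starRingEnd ℂ (2 * π * Complex.I * ((l * T⁻¹ : ℝ) : ℂ) * ((t + j * T : ℝ) : ℂ)) =
      -(2 * π * Complex.I * (l / T) * t) + ((-(l * j) : ℤ) : ℂ) * (2 * π * Complex.I) := by
    simp only [map_mul, Complex.conj_I, Complex.conj_ofReal, map_ofNat]
    push_cast
    field_simp
    ring
  rw [e, Complex.exp_add, Complex.exp_int_mul_two_pi_mul_I, mul_one]

/-! ### Bounds for the fibre form and for the Gabor sum -/

/-- The Toeplitz form is bounded above by the sum of its (nonnegative) coefficients: Schur's test. -/
lemma toeplitz_le {β : ℝ} (hβ : 0 < β) (S : Finset ℤ) (u : ℤ → ℂ) :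
    toeplitz β S u ≤ corrSum 1 β * ∑ j ∈ S, ‖u j‖ ^ 2 := by
  have hrow : ∀ i : ℤ, ∑ j ∈ S, corr β (i - j) ≤ corrSum 1 β := fun i => by
    have hs := (Equiv.subLeft i).summable_iff.2 (summable_corr hβ)
    have ht := (Equiv.subLeft i).tsum_eq fun m : ℤ => corr β m
    have := hs.sum_le_tsum S fun j _ => corr_nonneg hβ _
    rw [corrSum]
    simp only [one_zpow, one_mul]
    rw [← ht]
    exact this
  have h1 : toeplitz β S u ≤ ∑ i ∈ S, ∑ j ∈ S, corr β (i - j) * ((‖u i‖ ^ 2 + ‖u j‖ ^ 2) / 2) := by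
    refine Finset.sum_le_sum fun i _ => Finset.sum_le_sum fun j _ =>
      mul_le_mul_of_nonneg_left ?_ (corr_nonneg hβ _)
    have : (u i * starRingEnd ℂ (u j)).re ≤ ‖u i‖ * ‖u j‖ := by
      refine (Complex.re_le_norm _).trans ?_
      rw [norm_mul, RCLike.norm_conj]
    nlinarith [sq_nonneg (‖u i‖ - ‖u j‖)]
  have h2 : ∑ i ∈ S, ∑ j ∈ S, corr β (i - j) * ‖u i‖ ^ 2 ≤ corrSum 1 β * ∑ j ∈ S, ‖u j‖ ^ 2 := by
    rw [Finset.mul_sum]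
    refine Finset.sum_le_sum fun i _ => ?_
    rw [← Finset.sum_mul]
    exact mul_le_mul_of_nonneg_right (hrow i) (sq_nonneg _)
  have h3 : ∑ i ∈ S, ∑ j ∈ S, corr β (i - j) * ‖u j‖ ^ 2 =
      ∑ i ∈ S, ∑ j ∈ S, corr β (i - j) * ‖u i‖ ^ 2 := by
    rw [Finset.sum_comm]
    refine Finset.sum_congr rfl fun i _ => Finset.sum_congr rfl fun j _ => ?_
    rw [← corr_neg, neg_sub]
  have h4 : ∑ i ∈ S, ∑ j ∈ S, corr β (i - j) * ((‖u i‖ ^ 2 + ‖u j‖ ^ 2) / 2) =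
      (∑ i ∈ S, ∑ j ∈ S, corr β (i - j) * ‖u i‖ ^ 2 +
        ∑ i ∈ S, ∑ j ∈ S, corr β (i - j) * ‖u j‖ ^ 2) / 2 := by
    simp only [← Finset.sum_add_distrib, Finset.sum_div]
    refine Finset.sum_congr rfl fun i _ => Finset.sum_congr rfl fun j _ => by ring
  linarith

/-- The quadratic form by which the frame operator acts on the fibre over `τ`. -/
noncomputable def fibreForm (α : ℝ) (n : ℕ) (τ : ℝ) (S : Finset ℤ) (u : ℤ → ℂ) : ℝ :=
  sechPeriod α τ * ∑ j ∈ S, ‖u j‖ ^ 2 + n * toeplitz (n * α) S u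

/-- The lower frame bound for the parameter `α = π a / γ`. -/
noncomputable def lowerConst (α : ℝ) (n : ℕ) : ℝ :=
  n * (1 - (lowerProfile (π ^ 2 / α) + lowerProfile (n * α)))

/-- The upper frame bound for the parameter `α = π a / γ`. -/
noncomputable def upperConst (α : ℝ) (n : ℕ) : ℝ :=
  n * (1 + (upperProfile (π ^ 2 / α) + upperProfile (n * α)))

lemma lowerConst_eq {α : ℝ} (hα : 0 < α) (n : ℕ) : lowerConst α n =
    n * α / 2 * (sechPeriod α (α / 2) + n * corrSum (-1) (n * α)) := by
  rcases n.eq_zero_or_pos with rfl | hn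
  · simp [lowerConst]
  have hβ : 0 < n * α := by positivity
  have h := lowerProfile_add hα
  have h2 := sechPeriod_half hβ
  have h3 : lowerProfile (n * α) = n * α / 2 * sechPeriod (n * α) (n * α / 2) := rfl
  have h4 : lowerProfile α = α / 2 * sechPeriod α (α / 2) := rfl
  rw [h2] at h3
  rw [lowerConst]
  linear_combination -n * h - n * h3 + n * h4

lemma upperConst_eq {α : ℝ} (hα : 0 < α) (n : ℕ) : upperConst α n =
    n * α / 2 * (sechPeriod α 0 + n * corrSum 1 (n * α)) := by
  have h := sechPeriod_zero hα
  rw [upperConst, upperProfile, upperProfile]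
  linear_combination -n * h

lemma fibreForm_le {α : ℝ} (hα : 0 < α) {n : ℕ} (hn : n ≠ 0) (τ : ℝ) (S : Finset ℤ) (u : ℤ → ℂ) :
    n * α / 2 * fibreForm α n τ S u ≤ upperConst α n * ∑ j ∈ S, ‖u j‖ ^ 2 := by
  have hβ : 0 < n * α := by positivity
  have hU : 0 ≤ ∑ j ∈ S, ‖u j‖ ^ 2 := Finset.sum_nonneg fun _ _ => sq_nonneg _
  have h1 := mul_le_mul_of_nonneg_right (sechPeriod_le_zero hα τ) hU
  have h2 := mul_le_mul_of_nonneg_left (toeplitz_le hβ S u) n.cast_nonneg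
  rw [upperConst_eq hα, mul_assoc]
  refine mul_le_mul_of_nonneg_left ?_ (by positivity)
  rw [fibreForm]
  linarith

lemma le_fibreForm {α : ℝ} (hα : 0 < α) {n : ℕ} (hn : n ≠ 0) (τ : ℝ) (S : Finset ℤ) (u : ℤ → ℂ) :
    lowerConst α n * ∑ j ∈ S, ‖u j‖ ^ 2 ≤ n * α / 2 * fibreForm α n τ S u := by
  have hβ : 0 < n * α := by positivity
  have hU : 0 ≤ ∑ j ∈ S, ‖u j‖ ^ 2 := Finset.sum_nonneg fun _ _ => sq_nonneg _
  have h1 := mul_le_mul_of_nonneg_right (sechPeriod_half_le hα τ) hU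
  have h2 := mul_le_mul_of_nonneg_left (neg_le_toeplitz hβ (n * α / 2) S u) n.cast_nonneg
  rw [sechPeriod_half hβ] at h2
  rw [lowerConst_eq hα, mul_assoc]
  refine mul_le_mul_of_nonneg_left ?_ (by positivity)
  rw [fibreForm]
  linarith

lemma norm_sechWindow_le (γ t : ℝ) : ‖sechWindow γ t‖ ≤ √(π / (2 * γ)) := by
  rw [sechWindow, Complex.norm_real, norm_mul, norm_eq_abs, norm_eq_abs,
    abs_of_nonneg (sqrt_nonneg _), abs_of_pos (sech_pos _)]
  exact mul_le_of_le_one_right (sqrt_nonneg _) (sech_le_one _)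

lemma enorm_sq_eq_ofReal (z : ℂ) : ‖z‖ₑ ^ 2 = ENNReal.ofReal (‖z‖ ^ 2) := by
  rw [ENNReal.ofReal_pow (norm_nonneg z), ofReal_norm]

/-- The Gabor sum is an integral of fibre forms: Parseval in the modulations, the fibre identity
in the translations. -/
lemma gaborSum_cells {γ a b : ℝ} (hγ : 0 < γ) (ha : 0 < a) {n : ℕ} (hn : n ≠ 0)
    (hb : b = (n * a)⁻¹) {S : Finset ℤ} {F : ℝ → ℂ} (hF : MemLp F 2)
    (hS : ∀ t, F t ≠ 0 → ∃ j ∈ S, t ∈ Set.Ioc (j * (n * a)) (j * (n * a) + n * a)) :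
    gaborSum (sechWindow γ) (rectLattice a b) hF.toLp =
      ∫⁻ t in Set.Ioc 0 (n * a), ENNReal.ofReal (n * (π * a / γ) / 2 *
        fibreForm (π * a / γ) n (π * t / γ) S fun j => F (t + j * (n * a))) := by
  have hT : 0 < n * a := by positivity
  have hb0 : b ≠ 0 := by rw [hb]; positivity
  have hα : 0 < π * a / γ := by positivity
  rw [gaborSum_eq_tsum_tsum _ ha.ne' hb0]
  simp_rw [hb, tsum_stft_eq (memLp_sechWindow hγ) (continuous_sechWindow γ) (norm_sechWindow_le γ)
    hT hF hS]
  rw [ENNReal.tsum_mul_left, ← lintegral_tsum, ← lintegral_const_mul' _ _ ENNReal.ofReal_ne_top]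
  · congr 1
    funext t
    have h := hasSum_fibre hα hn (π * t / γ) S fun j => F (t + j * (n * a))
    have h2 := h.mul_left (π / (2 * γ))
    have e : ∀ k : ℤ, ‖∑ j ∈ S, F (t + j * (n * a)) *
        starRingEnd ℂ (sechWindow γ (t + j * (n * a) - k * a))‖ₑ ^ 2 =
        ENNReal.ofReal (π / (2 * γ) * ‖∑ j ∈ S, F (t + j * (n * a)) *
          (sech (π * t / γ + j * (n * (π * a / γ)) - k * (π * a / γ)) : ℂ)‖ ^ 2) := fun k => by
      rw [enorm_sq_eq_ofReal]
      congr 1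
      have e1 : ∑ j ∈ S, F (t + j * (n * a)) *
          starRingEnd ℂ (sechWindow γ (t + j * (n * a) - k * a)) =
          (√(π / (2 * γ)) : ℂ) * ∑ j ∈ S, F (t + j * (n * a)) *
          (sech (π * t / γ + j * (n * (π * a / γ)) - k * (π * a / γ)) : ℂ) := by
        rw [Finset.mul_sum]
        refine Finset.sum_congr rfl fun j _ => ?_
        rw [sechWindow, Complex.conj_ofReal]
        have : π * (t + j * (n * a) - k * a) / γ =
          π * t / γ + j * (n * (π * a / γ)) - k * (π * a / γ) := by ring
        rw [this]
        push_cast; ring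
      rw [e1, norm_mul, mul_pow, Complex.norm_real, norm_eq_abs, sq_abs, sq_sqrt (by positivity)]
    simp_rw [e]
    rw [← ENNReal.ofReal_tsum_of_nonneg (fun k => by positivity) h2.summable, h2.tsum_eq,
      ← ENNReal.ofReal_mul hT.le]
    congr 1
    rw [fibreForm]
    field_simp
  · intro k
    have hm : AEStronglyMeasurable (fun t => ∑ j ∈ S, F (t + j * (n * a)) *
        starRingEnd ℂ (sechWindow γ (t + j * (n * a) - k * a))) volume := by
      refine Finset.aestronglyMeasurable_fun_sum S fun j _ => ?_
      have h1 : MemLp (fun t => F (t + j * (n * a))) 2 :=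
        hF.comp_measurePreserving (measurePreserving_add_right volume ((j : ℝ) * (n * a)))
      have hc : Continuous fun t : ℝ => starRingEnd ℂ (sechWindow γ (t + j * (n * a) - k * a)) :=
        Complex.continuous_conj.comp ((continuous_sechWindow γ).comp (by fun_prop))
      exact h1.1.mul hc.aestronglyMeasurable
    exact (hm.enorm.pow_const 2).restrict

lemma enorm_sq_toLp {F : ℝ → ℂ} (hF : MemLp F 2) : ‖hF.toLp‖ₑ ^ 2 = ∫⁻ t, ‖F t‖ₑ ^ 2 := by
  rw [Lp.enorm_toLp]
  have := eLpNorm_nnreal_pow_eq_lintegral (f := F) (μ := volume) (p := 2) two_ne_zero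
  simpa [ENNReal.rpow_two] using this

lemma enorm_sq_cells {T : ℝ} (hT : 0 < T) {S : Finset ℤ} {F : ℝ → ℂ} (hF : MemLp F 2)
    (hS : ∀ t, F t ≠ 0 → ∃ j ∈ S, t ∈ Set.Ioc (j * T) (j * T + T)) :
    ‖hF.toLp‖ₑ ^ 2 = ∫⁻ t in Set.Ioc 0 T, ENNReal.ofReal (∑ j ∈ S, ‖F (t + j * T)‖ ^ 2) := by
  rw [enorm_sq_toLp, lintegral_cells hT (hF.1.enorm.pow_const 2) fun t ht => hS t fun h => ht
    (by simp [h])]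
  congr 1
  funext t
  rw [ENNReal.ofReal_sum_of_nonneg fun _ _ => sq_nonneg _]
  exact Finset.sum_congr rfl fun j _ => enorm_sq_eq_ofReal _

/-- The square integrable functions supported in finitely many cells are dense. -/
lemma dense_cells {T : ℝ} (hT : 0 < T) : Dense {f : Lp ℂ 2 (volume : Measure ℝ) |
    ∃ (S : Finset ℤ) (F : ℝ → ℂ) (hF : MemLp F 2), f = hF.toLp ∧
      ∀ t, F t ≠ 0 → ∃ j ∈ S, t ∈ Set.Ioc (j * T) (j * T + T)} := by
  intro f
  rw [EMetric.mem_closure_iff]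
  intro ε hε
  obtain ⟨F, hFc, hFe, -, hF⟩ := (Lp.memLp f).exists_hasCompactSupport_eLpNorm_sub_le
    ENNReal.ofNat_ne_top (ε := ε / 2) (ENNReal.half_pos hε.ne').ne'
  rcases eq_or_ne ε ⊤ with rfl | hε'
  · refine ⟨0, ⟨∅, 0, MemLp.zero, MemLp.toLp_zero _ |>.symm, fun t ht => absurd rfl ht⟩, ?_⟩
    exact edist_lt_top _ _
  obtain ⟨R, hR⟩ := hFc.isBounded.exists_norm_le
  refine ⟨hF.toLp, ⟨Finset.Icc (-(⌈R / T⌉ + 1)) ⌈R / T⌉, F, hF, rfl, fun t ht => ?_⟩, ?_⟩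
  · have htR : |t| ≤ R := hR t (subset_tsupport F ht)
    have hlo : ((⌈t / T⌉ : ℤ) : ℝ) < t / T + 1 := Int.ceil_lt_add_one _
    have hhi : t / T ≤ ⌈t / T⌉ := Int.le_ceil _
    have hRc : R / T ≤ ⌈R / T⌉ := Int.le_ceil _
    rw [abs_le] at htR
    refine ⟨⌈t / T⌉ - 1, Finset.mem_Icc.2 ⟨?_, ?_⟩, ?_, ?_⟩
    · have : -(R / T) ≤ t / T := by rw [← neg_div]; gcongr; exact htR.1
      have h2 : (-(⌈R / T⌉ : ℝ)) ≤ ⌈t / T⌉ := by linarith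
      have h3 : -⌈R / T⌉ ≤ ⌈t / T⌉ := by exact_mod_cast h2
      omega
    · have : ⌈t / T⌉ ≤ ⌈R / T⌉ := Int.ceil_le_ceil (by gcongr; exact htR.2)
      omega
    · push_cast
      rw [← sub_lt_iff_lt_add, lt_div_iff₀ hT] at hlo
      exact hlo
    · push_cast
      rw [div_le_iff₀ hT] at hhi
      linarith
  · rw [Lp.edist_def]
    refine lt_of_le_of_lt ?_ (ENNReal.half_lt_self hε.ne' hε')
    refine le_trans (le_of_eq ?_) hFe
    refine eLpNorm_congr_ae ?_
    filter_upwards [hF.coeFn_toLp] with t ht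
    simp [ht]

lemma gaborSum_cells_bounds {γ a b : ℝ} (hγ : 0 < γ) (ha : 0 < a) {n : ℕ} (hn : n ≠ 0)
    (hb : b = (n * a)⁻¹) {S : Finset ℤ} {F : ℝ → ℂ} (hF : MemLp F 2)
    (hS : ∀ t, F t ≠ 0 → ∃ j ∈ S, t ∈ Set.Ioc (j * (n * a)) (j * (n * a) + n * a)) :
    ENNReal.ofReal (lowerConst (π * a / γ) n) * ‖hF.toLp‖ₑ ^ 2 ≤
        gaborSum (sechWindow γ) (rectLattice a b) hF.toLp ∧
      gaborSum (sechWindow γ) (rectLattice a b) hF.toLp ≤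
        ENNReal.ofReal (upperConst (π * a / γ) n) * ‖hF.toLp‖ₑ ^ 2 := by
  have hT : 0 < n * a := by positivity
  have hα : 0 < π * a / γ := by positivity
  have hU : ∀ t, 0 ≤ ∑ j ∈ S, ‖F (t + j * (n * a))‖ ^ 2 :=
    fun t => Finset.sum_nonneg fun _ _ => sq_nonneg _
  rw [gaborSum_cells hγ ha hn hb hF hS, enorm_sq_cells hT hF hS,
    ← lintegral_const_mul' _ _ ENNReal.ofReal_ne_top,
    ← lintegral_const_mul' _ _ ENNReal.ofReal_ne_top]
  constructor <;> refine lintegral_mono fun t => ?_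
  · rw [← ENNReal.ofReal_mul' (hU t)]
    exact ENNReal.ofReal_le_ofReal (le_fibreForm hα hn _ S _)
  · rw [← ENNReal.ofReal_mul' (hU t)]
    exact ENNReal.ofReal_le_ofReal (fibreForm_le hα hn _ S _)

lemma continuous_enorm_sq_mul {c : ℝ≥0∞} (hc : c ≠ ⊤) :
    Continuous fun f : Lp ℂ 2 (volume : Measure ℝ) => c * ‖f‖ₑ ^ 2 :=
  (ENNReal.continuous_const_mul hc).comp ((ENNReal.continuous_pow 2).comp continuous_enorm)

/-- An upper frame inequality on a dense set extends to the whole space. -/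
lemma gaborSum_le_of_dense {g : ℝ → ℂ} (hg : MemLp g 2) (Λ : AddSubgroup (ℝ × ℝ)) {B : ℝ≥0∞}
    (hB : B ≠ ⊤) {D : Set (Lp ℂ 2 (volume : Measure ℝ))} (hD : Dense D)
    (h : ∀ f ∈ D, gaborSum g Λ f ≤ B * ‖f‖ₑ ^ 2) (f : Lp ℂ 2 (volume : Measure ℝ)) :
    gaborSum g Λ f ≤ B * ‖f‖ₑ ^ 2 := by
  rw [gaborSum, ENNReal.tsum_eq_iSup_sum]
  refine iSup_le fun s => ?_
  have hcl : IsClosed {f : Lp ℂ 2 (volume : Measure ℝ) |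
      ∑ l ∈ s, ‖stft g f (l : Λ)‖ₑ ^ 2 ≤ B * ‖f‖ₑ ^ 2} :=
    isClosed_le (continuous_finsetSum s fun l _ =>
      (ENNReal.continuous_pow 2).comp (continuous_enorm.comp (continuous_stft hg _)))
      (continuous_enorm_sq_mul hB)
  have hsub := closure_minimal (fun f hf => (ENNReal.sum_le_tsum s).trans (h f hf) :
    D ⊆ {f | ∑ l ∈ s, ‖stft g f (l : Λ)‖ₑ ^ 2 ≤ B * ‖f‖ₑ ^ 2}) hcl
  exact hsub (hD f)

lemma enorm_sq_le_add (x y : ℂ) {ε : NNReal} (hε : 0 < ε) :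
    ‖x‖ₑ ^ 2 ≤ (1 + ε : NNReal) * ‖y‖ₑ ^ 2 + (1 + ε⁻¹ : NNReal) * ‖x - y‖ₑ ^ 2 := by
  simp only [enorm_eq_nnnorm]
  norm_cast
  rw [← NNReal.coe_le_coe]
  push_cast
  have hε' : (0 : ℝ) < ε := hε
  have h1 : ‖x‖ ≤ ‖y‖ + ‖x - y‖ := by
    have := norm_add_le y (x - y)
    rwa [add_sub_cancel] at this
  have h2 : 2 * (‖y‖ * ‖x - y‖) ≤ ε * ‖y‖ ^ 2 + (ε : ℝ)⁻¹ * ‖x - y‖ ^ 2 := by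
    have h3 : ε * (‖y‖ - (ε : ℝ)⁻¹ * ‖x - y‖) ^ 2 =
        ε * ‖y‖ ^ 2 + (ε : ℝ)⁻¹ * ‖x - y‖ ^ 2 - 2 * (‖y‖ * ‖x - y‖) := by
      field_simp
      ring
    have : 0 ≤ ε * (‖y‖ - (ε : ℝ)⁻¹ * ‖x - y‖) ^ 2 := by positivity
    linarith
  calc ‖x‖ ^ 2 ≤ (‖y‖ + ‖x - y‖) ^ 2 := pow_le_pow_left₀ (norm_nonneg x) h1 2
    _ ≤ _ := by nlinarith

/-- A lower frame inequality on a dense set extends to the whole space, if there is an upper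
frame bound. -/
lemma le_gaborSum_of_dense {g : ℝ → ℂ} (hg : MemLp g 2) (Λ : AddSubgroup (ℝ × ℝ)) {A B : ℝ≥0∞}
    (hA : A ≠ ⊤) (hB : B ≠ ⊤) (hup : ∀ f, gaborSum g Λ f ≤ B * ‖f‖ₑ ^ 2)
    {D : Set (Lp ℂ 2 (volume : Measure ℝ))} (hD : Dense D)
    (h : ∀ f ∈ D, A * ‖f‖ₑ ^ 2 ≤ gaborSum g Λ f) (f : Lp ℂ 2 (volume : Measure ℝ)) :
    A * ‖f‖ₑ ^ 2 ≤ gaborSum g Λ f := by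
  have hfin : gaborSum g Λ f ≠ ⊤ :=
    ne_top_of_le_ne_top (ENNReal.mul_ne_top hB (ENNReal.pow_ne_top enorm_ne_top)) (hup f)
  have key : ∀ ε : NNReal, 0 < ε →
      A * ‖f‖ₑ ^ 2 ≤ (1 + ε : NNReal) * gaborSum g Λ f := fun ε hε => by
    have hcl : IsClosed {h : Lp ℂ 2 (volume : Measure ℝ) | A * ‖h‖ₑ ^ 2 ≤
        (1 + ε : NNReal) * gaborSum g Λ f + (1 + ε⁻¹ : NNReal) * B * ‖h - f‖ₑ ^ 2} :=
      isClosed_le (continuous_enorm_sq_mul hA) (continuous_const.add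
        ((continuous_enorm_sq_mul (ENNReal.mul_ne_top ENNReal.coe_ne_top hB)).comp
          (continuous_id.sub continuous_const)))
    have hsub : D ⊆ {h : Lp ℂ 2 (volume : Measure ℝ) | A * ‖h‖ₑ ^ 2 ≤
        (1 + ε : NNReal) * gaborSum g Λ f + (1 + ε⁻¹ : NNReal) * B * ‖h - f‖ₑ ^ 2} :=
      fun u hu => by
        refine (h u hu).trans ?_
        calc gaborSum g Λ u ≤ (1 + ε : NNReal) * gaborSum g Λ f +
              (1 + ε⁻¹ : NNReal) * gaborSum g Λ (u - f) := by
              simp only [gaborSum]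
              rw [← ENNReal.tsum_mul_left, ← ENNReal.tsum_mul_left, ← ENNReal.tsum_add]
              refine ENNReal.tsum_le_tsum fun l => ?_
              rw [stft_sub hg]
              exact enorm_sq_le_add _ _ hε
          _ ≤ _ := by
              rw [mul_assoc]
              gcongr
              exact hup _
    have := closure_minimal hsub hcl (hD f)
    simpa using this
  have hlim : Tendsto (fun ε : NNReal => ((1 + ε : NNReal) : ℝ≥0∞) * gaborSum g Λ f) (𝓝[>] 0)
      (𝓝 (((1 + 0 : NNReal) : ℝ≥0∞) * gaborSum g Λ f)) := by
    refine ENNReal.Tendsto.mul_const ?_ (Or.inr hfin)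
    rw [ENNReal.tendsto_coe]
    exact (tendsto_const_nhds.add tendsto_id).mono_left nhdsWithin_le_nhds
  have := ge_of_tendsto hlim (eventually_mem_nhdsWithin.mono fun ε hε => key ε hε)
  simpa using this

lemma gaborSum_le {γ a b : ℝ} (hγ : 0 < γ) (ha : 0 < a) {n : ℕ} (hn : n ≠ 0)
    (hb : b = (n * a)⁻¹) (f : Lp ℂ 2 (volume : Measure ℝ)) :
    gaborSum (sechWindow γ) (rectLattice a b) f ≤
      ENNReal.ofReal (upperConst (π * a / γ) n) * ‖f‖ₑ ^ 2 := by
  refine gaborSum_le_of_dense (memLp_sechWindow hγ) _ ENNReal.ofReal_ne_top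
    (dense_cells (by positivity : 0 < n * a)) ?_ f
  rintro f ⟨S, F, hF, rfl, hS⟩
  exact (gaborSum_cells_bounds hγ ha hn hb hF hS).2

lemma le_gaborSum {γ a b : ℝ} (hγ : 0 < γ) (ha : 0 < a) {n : ℕ} (hn : n ≠ 0)
    (hb : b = (n * a)⁻¹) (f : Lp ℂ 2 (volume : Measure ℝ)) :
    ENNReal.ofReal (lowerConst (π * a / γ) n) * ‖f‖ₑ ^ 2 ≤
      gaborSum (sechWindow γ) (rectLattice a b) f := by
  refine le_gaborSum_of_dense (memLp_sechWindow hγ) _ ENNReal.ofReal_ne_top ENNReal.ofReal_ne_top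
    (gaborSum_le hγ ha hn hb) (dense_cells (by positivity : 0 < n * a)) ?_ f
  rintro f ⟨S, F, hF, rfl, hS⟩
  exact (gaborSum_cells_bounds hγ ha hn hb hF hS).1

/-! ### Sharpness of the bounds -/

/-- The first `N` integers. -/
def natSupport (N : ℕ) : Finset ℤ := (Finset.range N).map Nat.castEmbedding

/-- Passing from `N` to `N + 1` adds one row and one column to the Toeplitz form. -/
lemma toeplitz_natSupport {β ε : ℝ} (hε : ε ^ 2 = 1) (N : ℕ) :
    toeplitz β (natSupport N) (fun j => ((ε ^ j : ℝ) : ℂ)) =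
      ∑ k ∈ Finset.range N, 2 * ∑ j ∈ Finset.range k, ε ^ (j + 1) * corr β (j + 1) := by
  have hmul : ∀ i j : ℕ, j ≤ i → ε ^ i * ε ^ j = ε ^ (i - j) := fun i j hij => by
    obtain ⟨m, rfl⟩ := Nat.exists_eq_add_of_le hij
    rw [Nat.add_sub_cancel_left, pow_add]
    have : ε ^ j * ε ^ j = 1 := by rw [← sq, ← pow_mul, mul_comm, pow_mul, hε, one_pow]
    linear_combination ε ^ m * this
  have h0 : ∀ N : ℕ, toeplitz β (natSupport N) (fun j => ((ε ^ j : ℝ) : ℂ)) =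
      ∑ i ∈ Finset.range N, ∑ j ∈ Finset.range N, corr β ((i : ℤ) - j) * (ε ^ i * ε ^ j) :=
    fun N => by
      simp only [toeplitz, natSupport, Finset.sum_map, Nat.castEmbedding_apply, zpow_natCast,
        Complex.conj_ofReal, ← Complex.ofReal_mul, Complex.ofReal_re]
  induction N with
  | zero => simp [toeplitz, natSupport]
  | succ N ih =>
    rw [Finset.sum_range_succ, ← ih, h0, h0, Finset.sum_range_succ]
    simp_rw [Finset.sum_range_succ _ N]
    rw [Finset.sum_add_distrib, sub_self, corr_zero, zero_mul, add_zero]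
    have e1 : ∑ j ∈ Finset.range N, corr β ((N : ℤ) - j) * (ε ^ N * ε ^ j) =
        ∑ j ∈ Finset.range N, ε ^ (j + 1) * corr β (j + 1) := by
      rw [← Finset.sum_range_reflect]
      refine Finset.sum_congr rfl fun j hj => ?_
      have hj' := Finset.mem_range.1 hj
      rw [hmul _ _ (by omega)]
      have a1 : N - (N - 1 - j) = j + 1 := by omega
      have a2 : (N : ℤ) - ((N - 1 - j : ℕ) : ℤ) = (j : ℤ) + 1 := by omega
      rw [a1, a2, mul_comm]
    have e2 : ∑ i ∈ Finset.range N, corr β ((i : ℤ) - N) * (ε ^ i * ε ^ N) =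
        ∑ j ∈ Finset.range N, corr β ((N : ℤ) - j) * (ε ^ N * ε ^ j) :=
      Finset.sum_congr rfl fun i _ => by rw [← corr_neg, neg_sub, mul_comm (ε ^ i)]
    rw [e2, e1]
    ring

/-- The Toeplitz form on long characters: its mean value tends to the symbol. -/
lemma tendsto_toeplitz {β : ℝ} (hβ : 0 < β) {ε : ℝ} (hε : ε ^ 2 = 1) :
    Tendsto (fun N : ℕ => (N : ℝ)⁻¹ * toeplitz β (natSupport N) fun j => ((ε ^ j : ℝ) : ℂ))
      atTop (𝓝 (corrSum ε β)) := by
  simp_rw [toeplitz_natSupport hε]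
  refine Filter.Tendsto.cesaro ?_
  have hs := summable_sign_corr hβ hε
  have hpow : ∀ k : ℕ, ε ^ ((k : ℤ) + 1) = ε ^ (k + 1) := fun k => by
    exact_mod_cast zpow_natCast ε (k + 1)
  have h1 : Summable fun k : ℕ => ε ^ (k + 1) * corr β (k + 1) := by
    refine (hs.comp_injective (i := fun k : ℕ => (k : ℤ) + 1)
      fun a b h => by simpa using h).congr fun k => ?_
    simp only [Function.comp, hpow]
  have hinv : ε⁻¹ = ε := by
    rcases sq_eq_one_iff.1 hε with rfl | rfl <;> norm_num
  have hneg : ∀ k : ℕ, ε ^ (-((k : ℤ) + 1)) * corr β (-((k : ℤ) + 1)) =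
      ε ^ (k + 1) * corr β (k + 1) := fun k => by
    rw [corr_neg, zpow_neg, ← inv_zpow, hinv, hpow]
  have h2 : corrSum ε β = 2 * ∑' k : ℕ, ε ^ (k + 1) * corr β (k + 1) := by
    rw [corrSum, tsum_of_add_one_of_neg_add_one (f := fun m : ℤ => ε ^ m * corr β m)
      (by simpa only [hpow] using h1) (by simpa only [hneg] using h1)]
    simp only [hneg, hpow, corr_zero, mul_zero, add_zero]
    ring
  rw [h2]
  exact h1.hasSum.tendsto_sum_nat.const_mul 2

lemma continuous_sechPeriod {α : ℝ} (hα : 0 < α) : Continuous (sechPeriod α) := by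
  have hs := summable_sinhRatio (by positivity : 0 < π ^ 2 / α)
  have hc : Continuous fun z : ℝ => ∑' m : ℤ, (sinhRatio (π ^ 2 / α * m) : ℂ) *
      Complex.exp (2 * π * Complex.I * m * z) := by
    refine continuous_tsum (fun m => by fun_prop) hs fun m z => ?_
    have : 2 * (π : ℂ) * Complex.I * m * z = (2 * π * m * z : ℝ) * Complex.I := by
      push_cast; ring
    rw [norm_mul, this, Complex.norm_exp_ofReal_mul_I, mul_one, Complex.norm_real,
        norm_eq_abs, abs_of_pos (sinhRatio_pos _)]
  have h : sechPeriod α = fun τ => 2 / α * (∑' m : ℤ, (sinhRatio (π ^ 2 / α * m) : ℂ) *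
      Complex.exp (2 * π * Complex.I * m * (τ / α : ℝ))).re := by
    funext τ
    rw [← poisson_sech_sq hα, Complex.ofReal_re, mul_div_cancel₀ _ hα.ne']
    field_simp
  rw [h]
  exact continuous_const.mul (Complex.continuous_re.comp (hc.comp (continuous_id.div_const α)))

lemma fibreForm_congr {α : ℝ} {n : ℕ} {τ : ℝ} {S : Finset ℤ} {u v : ℤ → ℂ}
    (h : ∀ j ∈ S, u j = v j) : fibreForm α n τ S u = fibreForm α n τ S v := by
  have h1 : ∑ j ∈ S, ‖u j‖ ^ 2 = ∑ j ∈ S, ‖v j‖ ^ 2 :=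
    Finset.sum_congr rfl fun j hj => by rw [h j hj]
  have h2 : toeplitz (n * α) S u = toeplitz (n * α) S v :=
    Finset.sum_congr rfl fun i hi => Finset.sum_congr rfl fun j hj => by rw [h i hi, h j hj]
  rw [fibreForm, fibreForm, h1, h2]

lemma fibreForm_zero (α : ℝ) (n : ℕ) (τ : ℝ) (S : Finset ℤ) :
    fibreForm α n τ S (fun _ => 0) = 0 := by simp [fibreForm, toeplitz]

/-- A step function concentrated near `t₀ + T ℤ`, with the values `ε ^ j` on the cells
`0 ≤ j < N`. -/
noncomputable def comb (T t₀ δ ε : ℝ) (N : ℕ) (t : ℝ) : ℂ :=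
  ∑ j ∈ natSupport N,
    (Set.Ioc (t₀ + j * T) (t₀ + j * T + δ)).indicator (fun _ => ((ε ^ j : ℝ) : ℂ)) t

lemma memLp_comb (T t₀ δ ε : ℝ) (N : ℕ) : MemLp (comb T t₀ δ ε N) 2 :=
  memLp_finsetSum _ fun _ _ => memLp_indicator_const 2 measurableSet_Ioc _ (Or.inr (by simp))

lemma comb_support {T t₀ δ ε : ℝ} (h0 : 0 ≤ t₀) (h1 : t₀ + δ ≤ T) {N : ℕ} (t : ℝ)
    (ht : comb T t₀ δ ε N t ≠ 0) :
    ∃ j ∈ natSupport N, t ∈ Set.Ioc (j * T) (j * T + T) := by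
  obtain ⟨j, hj, hne⟩ := Finset.exists_ne_zero_of_sum_ne_zero ht
  have := Set.mem_of_indicator_ne_zero hne
  exact ⟨j, hj, by linarith [this.1], by linarith [this.2]⟩

lemma comb_add {T t₀ δ ε : ℝ} (hT : 0 < T) (h0 : 0 ≤ t₀) (h1 : t₀ + δ ≤ T) {N : ℕ} {t : ℝ}
    (ht : t ∈ Set.Ioc 0 T) {j : ℤ} (hj : j ∈ natSupport N) :
    comb T t₀ δ ε N (t + j * T) =
      (Set.Ioc t₀ (t₀ + δ)).indicator (fun _ => ((ε ^ j : ℝ) : ℂ)) t := by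
  rw [comb, Finset.sum_eq_single_of_mem j hj]
  · simp only [Set.indicator_apply]
    refine if_congr ?_ rfl rfl
    constructor <;> rintro ⟨h2, h3⟩ <;> constructor <;> linarith
  · intro i _ hij
    refine Set.indicator_of_notMem (fun hmem => ?_) _
    have hi : t + j * T ∈ Set.Ioc (i * T) (i * T + T) :=
      ⟨by linarith [hmem.1], by linarith [hmem.2]⟩
    have hj : t + j * T ∈ Set.Ioc (j * T) (j * T + T) :=
      ⟨by linarith [ht.1], by linarith [ht.2]⟩
    exact Set.disjoint_left.1 (pairwise_disjoint_cells hT hij) hi hj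

lemma sum_norm_sq_natSupport {ε : ℝ} (hε : ε ^ 2 = 1) (N : ℕ) :
    ∑ j ∈ natSupport N, ‖((ε ^ j : ℝ) : ℂ)‖ ^ 2 = N := by
  have : |ε| = 1 := by rcases sq_eq_one_iff.1 hε with rfl | rfl <;> simp
  have h : ∀ j : ℤ, ‖((ε ^ j : ℝ) : ℂ)‖ ^ 2 = 1 := fun j => by
    rw [Complex.norm_real, norm_zpow, norm_eq_abs, this, one_zpow, one_pow]
  simp_rw [h]
  simp [natSupport]

/-- Combs nearly realize the value of the symbol of the frame operator at a given point. -/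
lemma exists_comb {γ a b : ℝ} (hγ : 0 < γ) (ha : 0 < a) {n : ℕ} (hn : n ≠ 0)
    (hb : b = (n * a)⁻¹) {t₀ : ℝ} (h0 : 0 ≤ t₀) (h1 : t₀ < n * a) {ε : ℝ} (hε : ε ^ 2 = 1)
    {η : ℝ} (hη : 0 < η) {N : ℕ} (hN : N ≠ 0) :
    ∃ f : Lp ℂ 2 (volume : Measure ℝ), ‖f‖ₑ ^ 2 ≠ 0 ∧ ‖f‖ₑ ^ 2 ≠ ⊤ ∧
      ENNReal.ofReal (n * (π * a / γ) / 2 * (sechPeriod (π * a / γ) (π * t₀ / γ) - η + n *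
        ((N : ℝ)⁻¹ * toeplitz (n * (π * a / γ)) (natSupport N) fun j => ((ε ^ j : ℝ) : ℂ)))) *
          ‖f‖ₑ ^ 2 ≤ gaborSum (sechWindow γ) (rectLattice a b) f ∧
      gaborSum (sechWindow γ) (rectLattice a b) f ≤
      ENNReal.ofReal (n * (π * a / γ) / 2 * (sechPeriod (π * a / γ) (π * t₀ / γ) + η + n *
        ((N : ℝ)⁻¹ * toeplitz (n * (π * a / γ)) (natSupport N) fun j => ((ε ^ j : ℝ) : ℂ)))) *
          ‖f‖ₑ ^ 2 := by
  set α := π * a / γ with hαdef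
  have hα : 0 < α := by positivity
  have hT : 0 < n * a := by positivity
  have hN0 : (0 : ℝ) < N := by positivity
  have hcont : Continuous fun t => sechPeriod α (π * t / γ) :=
    (continuous_sechPeriod hα).comp (by fun_prop)
  obtain ⟨ρ, hρ, hclose⟩ := Metric.continuousAt_iff.1 (hcont.continuousAt (x := t₀)) η hη
  set δ := min (ρ / 2) (n * a - t₀) with hδdef
  have hδ : 0 < δ := lt_min (by linarith) (by linarith)
  have hδ1 : t₀ + δ ≤ n * a := by linarith [min_le_right (ρ / 2) (n * a - t₀)]
  have hδ2 : δ < ρ := by linarith [min_le_left (ρ / 2) (n * a - t₀)]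
  have hI : Set.Ioc t₀ (t₀ + δ) ⊆ Set.Ioc 0 (n * a) := Set.Ioc_subset_Ioc h0 hδ1
  have hcells := comb_support (ε := ε) (N := N) h0 hδ1
  set u : ℤ → ℂ := fun j => ((ε ^ j : ℝ) : ℂ) with hu
  -- every integral over a cell reduces to the short interval
  have hred : ∀ (P : ℝ → (ℤ → ℂ) → ℝ≥0∞), (∀ t v w, (∀ j ∈ natSupport N, v j = w j) →
      P t v = P t w) → (∀ t, P t (fun _ => 0) = 0) →
      ∫⁻ t in Set.Ioc 0 (n * a), P t (fun j => comb (n * a) t₀ δ ε N (t + j * (n * a))) =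
        ∫⁻ t in Set.Ioc t₀ (t₀ + δ), P t u := fun P hP hP0 => by
    have e : ∀ t ∈ Set.Ioc 0 (n * a),
        P t (fun j => comb (n * a) t₀ δ ε N (t + j * (n * a))) =
          (Set.Ioc t₀ (t₀ + δ)).indicator (fun t => P t u) t := fun t ht => by
      by_cases hmem : t ∈ Set.Ioc t₀ (t₀ + δ)
      · rw [Set.indicator_of_mem hmem]
        refine hP t _ _ fun j hj => ?_
        rw [comb_add hT h0 hδ1 ht hj, Set.indicator_of_mem hmem]
      · rw [Set.indicator_of_notMem hmem, ← hP0 t]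
        refine hP t _ _ fun j hj => ?_
        rw [comb_add hT h0 hδ1 ht hj, Set.indicator_of_notMem hmem]
    rw [setLIntegral_congr_fun measurableSet_Ioc e, setLIntegral_indicator measurableSet_Ioc,
      Set.inter_eq_left.2 hI]
  have hnorm : ‖(memLp_comb (n * a) t₀ δ ε N).toLp‖ₑ ^ 2 = ENNReal.ofReal (N * δ) := by
    rw [enorm_sq_cells hT _ hcells, hred (fun _ v => ENNReal.ofReal (∑ j ∈ natSupport N, ‖v j‖ ^ 2))
      (fun t v w h => by rw [Finset.sum_congr rfl fun j hj => by rw [h j hj]]) (by simp)]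
    rw [sum_norm_sq_natSupport hε, setLIntegral_const, Real.volume_Ioc, add_sub_cancel_left,
      ENNReal.ofReal_mul hN0.le]
  have hsum : gaborSum (sechWindow γ) (rectLattice a b) (memLp_comb (n * a) t₀ δ ε N).toLp =
      ∫⁻ t in Set.Ioc t₀ (t₀ + δ),
        ENNReal.ofReal (n * α / 2 * fibreForm α n (π * t / γ) (natSupport N) u) := by
    rw [gaborSum_cells hγ ha hn hb _ hcells,
      hred (fun t v => ENNReal.ofReal (n * α / 2 * fibreForm α n (π * t / γ) (natSupport N) v))
      (fun t v w h => by rw [fibreForm_congr h]) (fun t => by rw [fibreForm_zero]; simp)]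
  have hval : ∀ t, fibreForm α n (π * t / γ) (natSupport N) u = N * (sechPeriod α (π * t / γ) +
      n * ((N : ℝ)⁻¹ * toeplitz (n * α) (natSupport N) u)) := fun t => by
    rw [fibreForm, sum_norm_sq_natSupport hε]
    field_simp
  have hnear : ∀ t ∈ Set.Ioc t₀ (t₀ + δ),
      |sechPeriod α (π * t / γ) - sechPeriod α (π * t₀ / γ)| < η := fun t ht => by
    refine hclose (x := t) ?_
    rw [dist_eq, abs_of_pos (by linarith [ht.1])]
    linarith [ht.2]
  have hconst : ∀ r : ℝ, ENNReal.ofReal r * ENNReal.ofReal (N * δ) =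
      ∫⁻ _ in Set.Ioc t₀ (t₀ + δ), ENNReal.ofReal (r * N) := fun r => by
    rw [setLIntegral_const, Real.volume_Ioc, add_sub_cancel_left, ENNReal.ofReal_mul hN0.le,
      ENNReal.ofReal_mul' hN0.le, mul_assoc]
  have hpos : 0 ≤ n * α / 2 * N := by positivity
  refine ⟨(memLp_comb (n * a) t₀ δ ε N).toLp, ?_, ?_, ?_, ?_⟩
  · rw [hnorm]; exact (ENNReal.ofReal_pos.2 (by positivity)).ne'
  · rw [hnorm]; exact ENNReal.ofReal_ne_top
  · rw [hnorm, hsum, hconst]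
    refine setLIntegral_mono' measurableSet_Ioc fun t ht => ENNReal.ofReal_le_ofReal ?_
    rw [hval]
    nlinarith [(abs_lt.1 (hnear t ht)).1]
  · rw [hnorm, hsum, hconst]
    refine setLIntegral_mono' measurableSet_Ioc fun t ht => ENNReal.ofReal_le_ofReal ?_
    rw [hval]
    nlinarith [(abs_lt.1 (hnear t ht)).2]

/-- The values realized by combs tend to the value of the symbol, with tolerances `η N → 0`. -/
lemma tendsto_comb_value {α : ℝ} (hα : 0 < α) {n : ℕ} (hn : n ≠ 0) (p : ℝ) {ε : ℝ}
    (hε : ε ^ 2 = 1) {η : ℕ → ℝ} (hη : Tendsto η atTop (𝓝 0)) :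
    Tendsto (fun N : ℕ => ENNReal.ofReal (n * α / 2 * (p + η (N + 1) + n * (((N + 1 : ℕ) : ℝ)⁻¹ *
      toeplitz (n * α) (natSupport (N + 1)) fun j => ((ε ^ j : ℝ) : ℂ))))) atTop
      (𝓝 (ENNReal.ofReal (n * α / 2 * (p + n * corrSum ε (n * α))))) := by
  refine ENNReal.tendsto_ofReal (Tendsto.const_mul _ ?_)
  have h1 := (tendsto_toeplitz (by positivity : 0 < n * α) hε).comp (tendsto_add_atTop_nat 1)
  have h2 := hη.comp (tendsto_add_atTop_nat 1)
  have := (h2.const_add p).add (h1.const_mul (n : ℝ))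
  rw [add_zero] at this
  exact this

lemma upperFrameBound_eq {γ a b : ℝ} (hγ : 0 < γ) (ha : 0 < a) {n : ℕ} (hn : n ≠ 0)
    (hb : b = (n * a)⁻¹) : upperFrameBound (sechWindow γ) (rectLattice a b) =
      ENNReal.ofReal (upperConst (π * a / γ) n) := by
  have hα : 0 < π * a / γ := by positivity
  refine le_antisymm (sInf_le (gaborSum_le hγ ha hn hb)) (le_sInf fun B hB => ?_)
  rw [upperConst_eq hα]
  have hη : Tendsto (fun N : ℕ => -(1 / (N : ℝ))) atTop (𝓝 0) := by
    simpa using (tendsto_one_div_atTop_nhds_zero_nat (𝕜 := ℝ)).neg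
  refine le_of_tendsto' (tendsto_comb_value hα hn _ (one_pow 2) hη) fun N => ?_
  obtain ⟨f, hf0, hft, h1, -⟩ := exists_comb hγ ha hn hb le_rfl (by positivity) (one_pow 2)
    (by positivity : (0 : ℝ) < 1 / ((N + 1 : ℕ) : ℝ)) N.succ_ne_zero
  have := h1.trans (hB f)
  rw [mul_zero, zero_div] at this
  exact (ENNReal.mul_le_mul_iff_left hf0 hft).1 this

lemma lowerFrameBound_eq {γ a b : ℝ} (hγ : 0 < γ) (ha : 0 < a) {n : ℕ} (hn : n ≠ 0)
    (hb : b = (n * a)⁻¹) : lowerFrameBound (sechWindow γ) (rectLattice a b) =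
      ENNReal.ofReal (lowerConst (π * a / γ) n) := by
  have hα : 0 < π * a / γ := by positivity
  refine le_antisymm (sSup_le fun A hA => ?_) (le_sSup (le_gaborSum hγ ha hn hb))
  rw [lowerConst_eq hα]
  have hε : (-1 : ℝ) ^ 2 = 1 := by norm_num
  have hlt : a / 2 < n * a := by
    have : (1 : ℝ) ≤ n := by exact_mod_cast Nat.one_le_iff_ne_zero.2 hn
    nlinarith
  refine ge_of_tendsto' (tendsto_comb_value hα hn _ hε tendsto_one_div_atTop_nhds_zero_nat)
    fun N => ?_
  obtain ⟨f, hf0, hft, -, h1⟩ := exists_comb hγ ha hn hb (by positivity) hlt hε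
    (by positivity : (0 : ℝ) < 1 / ((N + 1 : ℕ) : ℝ)) N.succ_ne_zero
  have := (hA f).trans h1
  rw [show π * (a / 2) / γ = π * a / γ / 2 by ring] at this
  exact (ENNReal.mul_le_mul_iff_left hf0 hft).1 this

/-! ### Comparison of the frame bounds -/

lemma lowerConst_pos {α : ℝ} (hα : 0 < α) {n : ℕ} (hn : 2 ≤ n) : 0 < lowerConst α n := by
  have hn' : (2 : ℝ) ≤ n := by exact_mod_cast hn
  have h := lowerProfile_strictAnti hα (show α < n * α by nlinarith)
  have := lowerProfile_add hα
  exact mul_pos (by linarith) (by linarith)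

lemma lowerConst_le_upperConst {α : ℝ} (hα : 0 < α) {n : ℕ} (hn : n ≠ 0) :
    lowerConst α n ≤ upperConst α n := by
  have h1 : 0 < π ^ 2 / α := by positivity
  have h2 : 0 < n * α := by positivity
  refine mul_le_mul_of_nonneg_left ?_ n.cast_nonneg
  linarith [lowerProfile_nonneg h1, lowerProfile_nonneg h2, upperProfile_nonneg h1,
    upperProfile_nonneg h2]

lemma pi_div_sqrt {n : ℕ} (hn : n ≠ 0) :
    π ^ 2 / (π / √n) = π * √n ∧ n * (π / √n) = π * √n := by
  have h : √(n : ℝ) ≠ 0 := (sqrt_pos.2 (by positivity)).ne'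
  have h2 := sq_sqrt (n.cast_nonneg (α := ℝ))
  have := pi_pos.ne'
  constructor
  · field_simp
  · field_simp
    linarith

lemma dual_parameters {α : ℝ} (hα : 0 < α) {n : ℕ} (hne : α ≠ π / √n) (hn : n ≠ 0) :
    π ^ 2 / α * (n * α) = (π * √n) ^ 2 ∧ π ^ 2 / α ≠ π * √n := by
  have h : 0 < √(n : ℝ) := sqrt_pos.2 (by positivity)
  have h2 := sq_sqrt (n.cast_nonneg (α := ℝ))
  constructor
  · rw [mul_pow, h2]; field_simp
  · intro he
    refine hne ?_
    rw [div_eq_iff hα.ne'] at he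
    rw [eq_div_iff h.ne']
    have hpi := pi_pos
    have : π * π = π * (α * √n) := by linarith
    exact (mul_left_cancel₀ hpi.ne' this).symm

lemma lowerConst_lt {α : ℝ} (hα : 0 < α) {n : ℕ} (hn : 2 ≤ n) (hne : α ≠ π / √n) :
    lowerConst α n < lowerConst (π / √n) n := by
  have hn0 : n ≠ 0 := by omega
  obtain ⟨e1, e2⟩ := pi_div_sqrt hn0
  obtain ⟨h1, h2⟩ := dual_parameters hα hne hn0
  have := lowerProfile_lt_add hn (by positivity) h1 h2
  rw [lowerConst, lowerConst, e1, e2]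
  exact mul_lt_mul_of_pos_left (by linarith) (by positivity)

lemma upperConst_lt {α : ℝ} (hα : 0 < α) {n : ℕ} (hn : 2 ≤ n) (hne : α ≠ π / √n) :
    upperConst (π / √n) n < upperConst α n := by
  have hn0 : n ≠ 0 := by omega
  obtain ⟨e1, e2⟩ := pi_div_sqrt hn0
  obtain ⟨h1, h2⟩ := dual_parameters hα hne hn0
  have := upperProfile_lt_add hn (by positivity) h1 h2
  rw [upperConst, upperConst, e1, e2]
  exact mul_lt_mul_of_pos_left (by linarith) (by positivity)

lemma conditionNumber_lt {A B A' B' : ℝ} (hA : 0 < A) (hB : 0 < B) (hAA : A < A')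
    (hBB : B' < B) :
    ENNReal.ofReal B' / ENNReal.ofReal A' < ENNReal.ofReal B / ENNReal.ofReal A := by
  have hA' := hA.trans hAA
  rw [← ENNReal.ofReal_div_of_pos hA, ← ENNReal.ofReal_div_of_pos hA',
    ENNReal.ofReal_lt_ofReal_iff (div_pos hB hA), div_lt_div_iff₀ hA' hA]
  nlinarith

end Gabor

theorem corollary2p2 (γ : ℝ) (hγ : 0 < γ) (n : ℕ) (hn : 2 ≤ n)
    (a b : ℝ) (ha : 0 < a) (hb : 0 < b) (hab : (a * b)⁻¹ = (n : ℝ)) :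
    Gabor.IsGaborFrame (Gabor.sechWindow γ) (Gabor.rectLattice a b) ∧
    (Gabor.lowerFrameBound (Gabor.sechWindow γ) (Gabor.rectLattice a b) ≤
        Gabor.lowerFrameBound (Gabor.sechWindow γ)
          (Gabor.rectLattice (γ / Real.sqrt n) (1 / (γ * Real.sqrt n))) ∧
      (Gabor.lowerFrameBound (Gabor.sechWindow γ) (Gabor.rectLattice a b) =
        Gabor.lowerFrameBound (Gabor.sechWindow γ)
          (Gabor.rectLattice (γ / Real.sqrt n) (1 / (γ * Real.sqrt n))) ↔
        a = γ / Real.sqrt n ∧ b = 1 / (γ * Real.sqrt n))) ∧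
    (Gabor.upperFrameBound (Gabor.sechWindow γ)
          (Gabor.rectLattice (γ / Real.sqrt n) (1 / (γ * Real.sqrt n))) ≤
        Gabor.upperFrameBound (Gabor.sechWindow γ) (Gabor.rectLattice a b) ∧
      (Gabor.upperFrameBound (Gabor.sechWindow γ)
          (Gabor.rectLattice (γ / Real.sqrt n) (1 / (γ * Real.sqrt n))) =
        Gabor.upperFrameBound (Gabor.sechWindow γ) (Gabor.rectLattice a b) ↔
        a = γ / Real.sqrt n ∧ b = 1 / (γ * Real.sqrt n))) ∧
    (Gabor.conditionNumber (Gabor.sechWindow γ)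
          (Gabor.rectLattice (γ / Real.sqrt n) (1 / (γ * Real.sqrt n))) ≤
        Gabor.conditionNumber (Gabor.sechWindow γ) (Gabor.rectLattice a b) ∧
      (Gabor.conditionNumber (Gabor.sechWindow γ)
          (Gabor.rectLattice (γ / Real.sqrt n) (1 / (γ * Real.sqrt n))) =
        Gabor.conditionNumber (Gabor.sechWindow γ) (Gabor.rectLattice a b) ↔
        a = γ / Real.sqrt n ∧ b = 1 / (γ * Real.sqrt n))) := by
  have hn0 : n ≠ 0 := by omega
  have hn' : (0 : ℝ) < n := by positivity
  have hs : 0 < Real.sqrt n := Real.sqrt_pos.2 hn'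
  have hs2 : Real.sqrt n ^ 2 = n := Real.sq_sqrt hn'.le
  have ha0 : 0 < γ / Real.sqrt n := by positivity
  have hα : 0 < Real.pi * a / γ := by positivity
  have hb' : b = (n * a)⁻¹ := by
    rw [← hab]; field_simp
  have hb0 : 1 / (γ * Real.sqrt n) = (n * (γ / Real.sqrt n))⁻¹ := by
    rw [one_div]
    congr 1
    field_simp
    exact hs2
  have hα0 : Real.pi * (γ / Real.sqrt n) / γ = Real.pi / Real.sqrt n := by field_simp
  have hα0' : 0 < Real.pi / Real.sqrt n := by positivity
  -- the second condition follows from the first, as the density is fixed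
  have hiff : (a = γ / Real.sqrt n ∧ b = 1 / (γ * Real.sqrt n)) ↔
      Real.pi * a / γ = Real.pi / Real.sqrt n := by
    constructor
    · rintro ⟨h, -⟩
      rw [h, hα0]
    · intro h
      have hpi := Real.pi_pos
      have h1 : a = γ / Real.sqrt n := by
        rw [div_eq_div_iff hγ.ne' hs.ne', mul_assoc] at h
        rw [eq_div_iff hs.ne']
        exact mul_left_cancel₀ hpi.ne' h
      exact ⟨h1, by rw [hb', hb0, h1]⟩
  rw [hiff, Gabor.conditionNumber, Gabor.conditionNumber, Gabor.lowerFrameBound_eq hγ ha hn0 hb',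
    Gabor.lowerFrameBound_eq hγ ha0 hn0 hb0, Gabor.upperFrameBound_eq hγ ha hn0 hb',
    Gabor.upperFrameBound_eq hγ ha0 hn0 hb0, hα0]
  have hA := Gabor.lowerConst_pos hα hn
  have hAB := Gabor.lowerConst_le_upperConst hα hn0
  have hA0 := Gabor.lowerConst_pos hα0' hn
  refine ⟨⟨_, _, hA, hAB, fun f => ⟨Gabor.le_gaborSum hγ ha hn0 hb' f,
    Gabor.gaborSum_le hγ ha hn0 hb' f⟩⟩, ?_⟩
  by_cases h : Real.pi * a / γ = Real.pi / Real.sqrt n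
  · simp only [h, le_refl, true_and]
  · have h1 := Gabor.lowerConst_lt hα hn h
    have h2 := Gabor.upperConst_lt hα hn h
    have h3 := (ENNReal.ofReal_lt_ofReal_iff hA0).2 h1
    have h4 := (ENNReal.ofReal_lt_ofReal_iff (hA.trans_le hAB)).2 h2
    have h5 := Gabor.conditionNumber_lt hA (hA.trans_le hAB) h1 h2
    exact ⟨⟨h3.le, iff_of_false h3.ne h⟩, ⟨h4.le, iff_of_false h4.ne h⟩,
      ⟨h5.le, iff_of_false h5.ne h⟩⟩
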